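/- \textbf{Setting.} Let $d,\tau,T,n,k^*\ge 1$ be integers with $\tau\le T$, $\max(d,\tau)\le n\le dT$. Let $\mathbf\Lambda\in\mathcal M_{\tau,T}(\mathbb C)$, $\mathfrak m_0>0$, $\mathfrak m_{\mathbf\Lambda}:=\sup_{\ell,t}|\mathbf\Lambda_{\ell,t}|$, and let $\mathfrak m_{\mathbf\Lambda}(\tau)\ge 1$ be such that $\sup_{j,t}|(\mathbf T\mathbf\Lambda)_{j,t}|\le \mathfrak m_{\mathbf\Lambda}(\tau)\sup_{j,\ell}|\mathbf T_{j,\ell}|$ for all $\mathbf T\in\mathcal M_{d,\tau}(\mathbb R)$. Let $\mathbf T^0\in\mathcal M_{d,\tau}(\mathbb R)$ with $\sup_{j,\ell}|\mathbf T^0_{j,\ell}|\le \mathfrak m_0/\mathfrak m_{\mathbf\Lambda}(\tau)$, $\mathbf\Theta^0:=\mathbf T^0\mathbf\Lambda$. Put $\langle X,\mathbf A\rangle_{\mathcal F}=\sum_{j,t}X_{j,t}\mathbf A_{j,t}$ for $X$ real. One observes $(\mathbf X_i,Y_i)$, $1\le i\le n$, with $$Y_i=\langle \mathbf X_i,\mathbf\Theta^0+\varepsilon\rangle_{\mathcal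 F}+\xi_i ,$$ where the pairs $(\mathbf X_i,\xi_i)$ are independent, each $\mathbf X_i$ is independent of $\xi_i$, the family $(\mathbf X_i,\xi_i)_i$ is independent of $\varepsilon$, the $\mathbf X_i$ have a common law $\Pi$ on the set $\{e_je_t^*\,;\,1\le j\le d,\,1\le t\le T\}$ of $d\times T$ matrices with one entry $1$ and the others $0$, the $\xi_i$ are identically distributed and centered, and $\varepsilon$ is a $d\times T$ real random matrix with i.i.d. centered rows. \textbf{Assumptions.} (1) There is a process $(\varepsilon_t)_{t\in\mathbb Z}$ such that each row of $\varepsilon$ has the law of $(\varepsilon_1,\dots,\varepsilon_T)$; put $\Phi_\varepsilon:=1+\sum_{i=1}^n\phi_\varepsilon(i)^{1/2}$, where $\phi_\varepsilon(i)=\sup_{t\in\mathbb Z}\sup\{|\mathbb P(B)-\mathbb P(B|A)|\,;\,A\in\sigma(\varepsilon_h,h\le t),\,B\in\sigma(\varepsilon_l,l\ge t+i),\,\mathbb P(A)\ne0\}$. (2) There are $\mathfrak m_\varepsilon,\mathfrak v_\xi,\mathfrak c_\xi>0$ with $\sup_{j,t}|\varepsilon_{j,t}|\le\mathfrak m_\varepsilon$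 a.s., $\mathbb E(\xi_i^2)\le\mathfrak v_\xi$ and $\mathbb E(|\xi_i|^q)\le\mathfrak v_\xi\mathfrak c_\xi^{q-2}q!/2$ for all $i$ and all integers $q\ge3$. (3) There is $\mathfrak c_\Pi>0$ with $\Pi(\{e_je_t^*\})\le\mathfrak c_\Pi/(dT)$ for all $j,t$. \textbf{Constants.} Let $\mathfrak c=4\max\{4\mathfrak m_0^2,4\mathfrak v_\xi,4\mathfrak m_\varepsilon^2,2\mathfrak m_\varepsilon^2\Phi_\varepsilon^2\mathfrak c_\Pi\}$, $\lambda^*=(16\mathfrak m_0\max\{\mathfrak m_0,\mathfrak m_\varepsilon,\mathfrak c_\xi\})^{-1}$, $\mathfrak c_{\rm pen}=2(\mathfrak c^{-1}\wedge\lambda^*)^{-1}$, $\mathfrak a_1=32(\mathfrak c^{-1}\wedge\lambda^*)^{-1}$, $\mathfrak a_2=4\mathfrak m_{\mathbf\Lambda}(\mathfrak v_\xi^{1/2}+\mathfrak v_\xi/(2\mathfrak c_\xi)+\mathfrak m_\varepsilon+3\mathfrak m_0)$, $\mathfrak b=72\mathfrak m_0\mathfrak m_{\mathbf\Lambda}\mathfrak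 c_\xi+5\mathfrak a_1+9\mathfrak m_0\mathfrak a_2$, and $$\mathfrak c_1=4\mathfrak b+16\mathfrak c_{\rm pen}+72\mathfrak m_0\mathfrak c_\xi,\qquad \mathfrak c_2=9\mathfrak a_2\mathfrak m_0 .$$ \textbf{Estimator.} For $k\in\mathcal K=\{1,\dots,k^*\}$ let $\mathcal S_k$ be a set of matrices of the form $\mathbf U\mathbf V$ with $\mathbf U\in\mathcal M_{d,k}(\mathbb R)$, $\mathbf V\in\mathcal M_{k,\tau}(\mathbb R)$, all entries of $\mathbf U$ and $\mathbf V$ being at most $\sqrt{\mathfrak m_0/(k\,\mathfrak m_{\mathbf\Lambda}(\tau))}$ in absolute value. With $r_n(\mathbf A)=\frac1n\sum_{i=1}^n|Y_i-\langle\mathbf X_i,\mathbf A\rangle_{\mathcal F}|^2$, let $\widehat{\mathbf T}_k\in\arg\min_{\mathbf T\in\mathcal S_k}r_n(\mathbf T\mathbf\Lambda)$ (assumed to exist), $$\widehat k\in\arg\min_{k\in\mathcal K}\{r_n(\widehat{\mathbf T}_k\mathbf\Lambda)+\mathrm{pen}(k)\},\qquad \mathrm{pen}(k)=16\,\mathfrak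 c_{\rm pen}\frac{\log n}{n}k(d+\tau),$$ and $\widehat{\mathbf\Theta}=\widehat{\mathbf T}_{\widehat k}\mathbf\Lambda$. Put $\|\mathbf A\|_{\mathcal F,\Pi}^2=\int|\langle X,\mathbf A\rangle_{\mathcal F}|^2\,\Pi(dX)$. \textbf{Theorem.} For every $\alpha\in(0,1)$, with probability at least $1-\alpha$, $$\|\widehat{\mathbf\Theta}-\mathbf\Theta^0\|_{\mathcal F,\Pi}^2\le 4\min_{k\in\mathcal K}\Big\{3\inf_{\mathbf T\in\mathcal S_k}\|(\mathbf T-\mathbf T^0)\mathbf\Lambda\|_{\mathcal F,\Pi}^2+\mathfrak c_1k(d+\tau)\frac{\log n}{n}\Big\}+\frac{\mathfrak c_1}{n}\log\Big(\frac{4k^*}{\alpha}\Big)+\frac{\mathfrak c_2}{n}.$$ -/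

import Mathlib

open MeasureTheory ProbabilityTheory

namespace TSCompletion

/-! ### `φ`-mixing coefficients -/

/-- The `φ`-mixing coefficient `sup {|P(B) - P(B|A)| ; A ∈ 𝒜, B ∈ ℬ, P(A) ≠ 0}` between two
σ-algebras. -/
noncomputable def phiCoeff {Ω : Type*} [MeasurableSpace Ω] (P : Measure Ω)
    (𝒜 ℬ : MeasurableSpace Ω) : ℝ :=
  sSup {x : ℝ | ∃ A B : Set Ω, MeasurableSet[𝒜] A ∧ MeasurableSet[ℬ] B ∧ P A ≠ 0 ∧
    x = |P.real B - (ProbabilityTheory.cond P A).real B|}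

/-- `σ(Z_h, h ≤ t)`. -/
@[reducible] def pastSigma {Ω : Type*} (Z : ℤ → Ω → ℝ) (t : ℤ) : MeasurableSpace Ω :=
  ⨆ h : Set.Iic t, MeasurableSpace.comap (Z h) inferInstance

/-- `σ(Z_l, l ≥ t)`. -/
@[reducible] def futureSigma {Ω : Type*} (Z : ℤ → Ω → ℝ) (t : ℤ) : MeasurableSpace Ω :=
  ⨆ l : Set.Ici t, MeasurableSpace.comap (Z l) inferInstance

/-- The `i`-th `φ`-mixing coefficient of the process `Z`. -/
noncomputable def phiMixing {Ω : Type*} [MeasurableSpace Ω] (P : Measure Ω)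
    (Z : ℤ → Ω → ℝ) (i : ℕ) : ℝ :=
  ⨆ t : ℤ, phiCoeff P (pastSigma Z t) (futureSigma Z (t + i))

/-- `Φ = 1 + ∑_{i=1}^n φ_Z(i)^{1/2}`. -/
noncomputable def mixingSum {Ω : Type*} [MeasurableSpace Ω] (P : Measure Ω)
    (Z : ℤ → Ω → ℝ) (n : ℕ) : ℝ :=
  1 + ∑ i ∈ Finset.Icc 1 n, Real.sqrt (phiMixing P Z i)

/-! ### Matrices, norms and empirical risk

The structure matrix `Λ` may have complex entries, so the products `T Λ` are complex matrices and
squares are squared moduli. When `T Λ` is real this is the usual real quantity. -/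

/-- The product σ-algebra on matrices. -/
instance instMeasurableSpaceMatrix {m p : ℕ} {R : Type*} [MeasurableSpace R] :
    MeasurableSpace (Matrix (Fin m) (Fin p) R) :=
  inferInstanceAs (MeasurableSpace (Fin m → Fin p → R))

/-- The set `𝒳 = {e_j e_t^*}` of matrices with one entry `1` and all others `0`. -/
def entryMatrices (d T : ℕ) : Set (Matrix (Fin d) (Fin T) ℝ) :=
  {X | ∃ j t, X = Matrix.single j t 1}

/-- The Frobenius product `⟨X, A⟩ = trace(X^* A)`, for `X` real. -/
noncomputable def frobInner {d T : ℕ} (X : Matrix (Fin d) (Fin T) ℝ)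
    (A : Matrix (Fin d) (Fin T) ℂ) : ℂ :=
  ∑ j, ∑ t, (X j t : ℂ) * A j t

/-- A real matrix seen as a complex one. -/
noncomputable def toComplex {m p : ℕ} (A : Matrix (Fin m) (Fin p) ℝ) :
    Matrix (Fin m) (Fin p) ℂ :=
  A.map (fun x : ℝ => (x : ℂ))

/-- The product `S Λ`. -/
noncomputable def trend {d τ T : ℕ} (S : Matrix (Fin d) (Fin τ) ℝ)
    (Λ : Matrix (Fin τ) (Fin T) ℂ) : Matrix (Fin d) (Fin T) ℂ :=
  toComplex S * Λ

/-- `‖A‖²_{F,Π} = ∫ |⟨X, A⟩|² Π(dX)`. -/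
noncomputable def normSqPi {d T : ℕ} (law : Measure (Matrix (Fin d) (Fin T) ℝ))
    (A : Matrix (Fin d) (Fin T) ℂ) : ℝ :=
  ∫ X, ‖frobInner X A‖ ^ 2 ∂law

/-- `r_n(A) = n⁻¹ ∑ |Y_i - ⟨X_i, A⟩|²`, for given data. -/
noncomputable def empiricalRisk {d T n : ℕ} (Y : Fin n → ℂ)
    (X : Fin n → Matrix (Fin d) (Fin T) ℝ) (A : Matrix (Fin d) (Fin T) ℂ) : ℝ :=
  (1 / (n : ℝ)) * ∑ i, ‖Y i - frobInner (X i) A‖ ^ 2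

/-- The set `ℳ_{d,k,τ}` of products `U V`, the entries of `U` and `V` being at most
`√(m₀ / (k m_Λ(τ)))` in absolute value; `mΛτ` stands for `m_Λ(τ)`. -/
def factorSet (d k τ : ℕ) (m0 mΛτ : ℝ) : Set (Matrix (Fin d) (Fin τ) ℝ) :=
  {S | ∃ (U : Matrix (Fin d) (Fin k) ℝ) (V : Matrix (Fin k) (Fin τ) ℝ),
    (∀ j l, |U j l| ≤ Real.sqrt (m0 / (k * mΛτ))) ∧
    (∀ l t, |V l t| ≤ Real.sqrt (m0 / (k * mΛτ))) ∧ S = U * V}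

/-- `m_Λ = sup |Λ_{l,t}|`. -/
noncomputable def supEntry {τ T : ℕ} (Λ : Matrix (Fin τ) (Fin T) ℂ) : ℝ :=
  ⨆ p : Fin τ × Fin T, ‖Λ p.1 p.2‖

/-! ### The constants -/

/-- `4 max {4 m₀², 4 v_ξ, 4 m_ε², 2 m_ε² Φ² c_Π}`. -/
noncomputable def cExp (m0 vξ mε Φ cPi : ℝ) : ℝ :=
  4 * max (max (4 * m0 ^ 2) (4 * vξ)) (max (4 * mε ^ 2) (2 * mε ^ 2 * Φ ^ 2 * cPi))

/-- `λ^* = (16 m₀ max {m₀, m_ε, c_ξ})⁻¹`. -/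
noncomputable def lamStar (m0 cξ mε : ℝ) : ℝ :=
  (16 * m0 * max m0 (max mε cξ))⁻¹

/-- `c_pen = 2 (cExp⁻¹ ∧ λ^*)⁻¹`. -/
noncomputable def cPen (m0 vξ cξ mε Φ cPi : ℝ) : ℝ :=
  2 * (min (cExp m0 vξ mε Φ cPi)⁻¹ (lamStar m0 cξ mε))⁻¹

/-- `32 (cExp⁻¹ ∧ λ^*)⁻¹`. -/
noncomputable def cNet1 (m0 vξ cξ mε Φ cPi : ℝ) : ℝ :=
  32 * (min (cExp m0 vξ mε Φ cPi)⁻¹ (lamStar m0 cξ mε))⁻¹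

/-- `4 m_Λ (v_ξ^{1/2} + v_ξ / (2 c_ξ) + m_ε + 3 m₀)`. -/
noncomputable def cNet2 (m0 vξ cξ mε mΛ : ℝ) : ℝ :=
  4 * mΛ * (Real.sqrt vξ + vξ / (2 * cξ) + mε + 3 * m0)

/-- The constant of the fixed-rank risk bound:
`72 m₀ m_Λ c_ξ + 5 cNet1 + 9 m₀ cNet2`. -/
noncomputable def cFixed (m0 vξ cξ mε mΛ Φ cPi : ℝ) : ℝ :=
  72 * m0 * mΛ * cξ + 5 * cNet1 m0 vξ cξ mε Φ cPi + 9 * m0 * cNet2 m0 vξ cξ mε mΛ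

/-- `c₁ = 4 cFixed + 16 c_pen + 72 m₀ c_ξ`. -/
noncomputable def cAdapt1 (m0 vξ cξ mε mΛ Φ cPi : ℝ) : ℝ :=
  4 * cFixed m0 vξ cξ mε mΛ Φ cPi + 16 * cPen m0 vξ cξ mε Φ cPi + 72 * m0 * cξ

/-- `c₂ = 9 cNet2 m₀`. -/
noncomputable def cAdapt2 (m0 vξ cξ mε mΛ : ℝ) : ℝ :=
  9 * cNet2 m0 vξ cξ mε mΛ * m0

/-- `pen(k) = 16 c (log n / n) k (d + τ)`, where `c` stands for `c_pen`. -/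
noncomputable def pen (c : ℝ) (n d τ k : ℕ) : ℝ :=
  16 * c * (Real.log n / n) * (k * ((d : ℝ) + τ))

end TSCompletion

open TSCompletion

/-!
Write `f = A - Θ⁰` for a competitor `A = T Λ`, `v(f) = ‖f‖²_{F,Π}`, and let `R(f)` be the empirical
excess risk `r_n(A) - r_n(Θ⁰)`, whose mean is `v(f)`. The proof is the classical one for penalized
least squares: an exponential inequality for `R(f)` at a single `λ = n β`, applied through a union
bound to finite nets of the models (lower bounds on `R`) and to one near-minimizer of `v` in each
model (upper bounds on `R`).

*Exponential inequality* (`lintegral_exp_sum_excessLoss_noise_le`). Given the time series noise `ε`,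
the summands of `R(f)` are independent, and one of them has, by Bernstein's moment condition, an
exponential moment governed by its conditional mean `v(f) - 2 D(ε)` up to an error `β v(f) / 8`
(`lintegral_exp_excessLoss_le`). Here `D(ε) = ∑ Π_{jt} Re f_{jt} ε_{jt}` is the term `crossTerm`,
which no longer depends on the sample. It is a weighted sum over independent rows of a `φ`-mixing
process, hence sub-Gaussian (`hasSubgaussianMGF_crossTerm`): along a row, Azuma–Hoeffding applies to
the conditional expectations given the past, as `|E[ε_s | past up to t]| ≤ 2 m_ε φ(s - t)`. The
weights satisfy `∑ (Π_{jt} Re f_{jt})² ≤ c_Π v(f) / (d T)`, and `n ≤ d T` turns this into a variance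
proxy of order `v(f) / n`. The sum `Φ` contains the first `n` coefficients only, while a row has
`T` entries, and `T > n` is possible. A row is then cut into `⌊T / n⌋ + 1` blocks of length `n`
which are added without any information on their dependence; the factor `⌊T / n⌋ + 1` lost in the
variance proxy is compensated by the `T` in the bound on the weights (`sum_sq_crossWeights_le`).

*Nets.* Rounding every entry of the factors `U` and `V` to a grid of `n` points moves `U V` by at
most `2 m₀ / (m_Λ(τ) n)` (`exists_netPoint`), hence `U V Λ` by at most `2 m₀ / n`. The net of the `k`-th model has
`n ^ (k (d + τ))` points, and the step `β = (cExp⁻¹ ∧ λ^*) / 32` is such that `pen k` is exactly its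
entropy divided by `λ`. The rounding error of the empirical risk involves the mean of the `|ξ_i|`,
which is controlled by a separate deviation bound (`measure_sum_abs_ge_le`). The resulting inequality
has the factor `3` in front of the approximation error, and the remaining terms are far below those
of the statement (`oracle_arithmetic`).
-/

/-! ### Covariance inequalities for `φ`-mixing coefficients -/

section Mixing

variable {Ω : Type*} {𝒜 ℬ : MeasurableSpace Ω} [mΩ : MeasurableSpace Ω] {P : Measure Ω}

theorem abs_sub_cond_le_one [IsProbabilityMeasure P] {A : Set Ω} (_ : P A ≠ 0) (B : Set Ω) :
    |P.real B - (ProbabilityTheory.cond P A).real B| ≤ 1 := by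
  have := cond_isProbabilityMeasure ‹P A ≠ 0›
  have h1 : P.real B ≤ 1 := measureReal_le_one
  have h2 : (ProbabilityTheory.cond P A).real B ≤ 1 := measureReal_le_one
  have h3 : 0 ≤ P.real B := measureReal_nonneg
  have h4 : 0 ≤ (ProbabilityTheory.cond P A).real B := measureReal_nonneg
  rw [abs_le]
  constructor <;> linarith

theorem abs_sub_cond_le_phiCoeff [IsProbabilityMeasure P] {A B : Set Ω}
    (hA : MeasurableSet[𝒜] A) (hB : MeasurableSet[ℬ] B) (hPA : P A ≠ 0) :
    |P.real B - (ProbabilityTheory.cond P A).real B| ≤ phiCoeff P 𝒜 ℬ := by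
  refine le_csSup ⟨1, ?_⟩ ⟨A, B, hA, hB, hPA, rfl⟩
  rintro x ⟨A, B, -, -, hPA, rfl⟩
  exact abs_sub_cond_le_one hPA B

theorem phiCoeff_nonneg : 0 ≤ phiCoeff P 𝒜 ℬ := by
  refine Real.sSup_nonneg ?_
  rintro x ⟨A, B, -, -, -, rfl⟩
  exact abs_nonneg _

theorem phiCoeff_le_one [IsProbabilityMeasure P] :
    phiCoeff P 𝒜 ℬ ≤ 1 := by
  refine Real.sSup_le ?_ zero_le_one
  rintro x ⟨A, B, -, -, hPA, rfl⟩
  exact abs_sub_cond_le_one hPA B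

theorem phiMixing_nonneg (P : Measure Ω) (Z : ℤ → Ω → ℝ) (i : ℕ) : 0 ≤ phiMixing P Z i :=
  Real.iSup_nonneg fun _ => phiCoeff_nonneg

theorem phiMixing_le_one [IsProbabilityMeasure P] (Z : ℤ → Ω → ℝ) (i : ℕ) :
    phiMixing P Z i ≤ 1 :=
  Real.iSup_le (fun _ => phiCoeff_le_one) zero_le_one

theorem phiCoeff_le_phiMixing [IsProbabilityMeasure P] (Z : ℤ → Ω → ℝ) (t : ℤ) (i : ℕ) :
    phiCoeff P (pastSigma Z t) (futureSigma Z (t + i)) ≤ phiMixing P Z i := by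
  refine le_ciSup (f := fun t => phiCoeff P (pastSigma Z t) (futureSigma Z (t + i))) ⟨1, ?_⟩ t
  rintro x ⟨t, rfl⟩
  exact phiCoeff_le_one

/-- Both expectations are integrals of tail probabilities over `[0, 2m]`, and the tails differ by
at most the mixing coefficient. -/
theorem abs_integral_cond_le [IsProbabilityMeasure P]
    (hℬ : ℬ ≤ mΩ) {W : Ω → ℝ} (hW : Measurable[ℬ] W) {m : ℝ} (hm : 0 ≤ m)
    (hWm : ∀ᵐ ω ∂P, |W ω| ≤ m) (hW0 : ∫ ω, W ω ∂P = 0) {A : Set Ω} (hA : MeasurableSet[𝒜] A)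
    (hPA : P A ≠ 0) :
    |∫ ω, W ω ∂(ProbabilityTheory.cond P A)| ≤ 2 * m * phiCoeff P 𝒜 ℬ := by
  have := cond_isProbabilityMeasure hPA
  have hWmΩ : Measurable W := hW.mono hℬ le_rfl
  have hWm' : ∀ᵐ ω ∂(ProbabilityTheory.cond P A), |W ω| ≤ m :=
    (cond_absolutelyContinuous (μ := P) (s := A)).ae_le hWm
  have key : ∀ Q : Measure Ω, IsProbabilityMeasure Q → (∀ᵐ ω ∂Q, |W ω| ≤ m) →
      ∫ ω, W ω ∂Q + m = ∫ t in Set.Ioc 0 (2 * m), Q.real {ω | t ≤ W ω + m} := by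
    intro Q hQ hb
    have hi : Integrable W Q := Integrable.of_bound hWmΩ.aestronglyMeasurable m hb
    rw [← Integrable.integral_eq_integral_Ioc_meas_le (f := fun ω => W ω + m)]
    · rw [integral_add hi (integrable_const m)]; simp
    · exact hi.add (integrable_const m)
    · filter_upwards [hb] with ω h
      have := (abs_le.1 h).1
      simp only [Pi.zero_apply]; linarith
    · filter_upwards [hb] with ω h
      have := (abs_le.1 h).2
      linarith
  have hint : ∀ Q : Measure Ω, IsProbabilityMeasure Q →
      IntegrableOn (fun t => Q.real {ω | t ≤ W ω + m}) (Set.Ioc 0 (2 * m)) volume := by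
    intro Q hQ
    have hanti : Antitone (fun t => Q.real {ω | t ≤ W ω + m}) := fun s t hst =>
      measureReal_mono (fun ω (h : t ≤ W ω + m) => hst.trans h)
    refine Measure.integrableOn_of_bounded (M := 1)
      measure_Ioc_lt_top.ne hanti.measurable.aestronglyMeasurable ?_
    refine Filter.Eventually.of_forall fun t => ?_
    rw [Real.norm_eq_abs, abs_of_nonneg measureReal_nonneg]
    exact measureReal_le_one
  have e1 := key P inferInstance hWm
  have e2 := key _ inferInstance hWm'
  have e3 : -(∫ ω, W ω ∂(ProbabilityTheory.cond P A)) = ∫ t in Set.Ioc 0 (2 * m),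
      (P.real {ω | t ≤ W ω + m} - (ProbabilityTheory.cond P A).real {ω | t ≤ W ω + m}) := by
    rw [integral_sub (hint P inferInstance) (hint _ inferInstance), ← e1, ← e2, hW0]; ring
  rw [← abs_neg, e3, ← Real.norm_eq_abs]
  have := norm_setIntegral_le_of_norm_le_const (μ := volume) (s := Set.Ioc (0 : ℝ) (2 * m))
    (f := fun t => P.real {ω | t ≤ W ω + m} -
      (ProbabilityTheory.cond P A).real {ω | t ≤ W ω + m}) (C := phiCoeff P 𝒜 ℬ)
    measure_Ioc_lt_top ?_
  · refine this.trans (le_of_eq ?_)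
    rw [measureReal_def, Real.volume_Ioc, ENNReal.toReal_ofReal (by linarith)]; ring
  · intro t _
    rw [Real.norm_eq_abs]
    refine abs_sub_cond_le_phiCoeff hA ?_ hPA
    exact (hW.add_const m) measurableSet_Ici

theorem abs_setIntegral_le_phiCoeff [IsProbabilityMeasure P]
    (hℬ : ℬ ≤ mΩ) {W : Ω → ℝ} (hW : Measurable[ℬ] W) {m : ℝ} (hm : 0 ≤ m)
    (hWm : ∀ᵐ ω ∂P, |W ω| ≤ m) (hW0 : ∫ ω, W ω ∂P = 0) {A : Set Ω} (hA : MeasurableSet[𝒜] A) :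
    |∫ ω in A, W ω ∂P| ≤ 2 * m * phiCoeff P 𝒜 ℬ * P.real A := by
  by_cases hPA : P A = 0
  · rw [Measure.restrict_eq_zero.2 hPA]
    simp [measureReal_def, hPA]
  · have h := abs_integral_cond_le (𝒜 := 𝒜) hℬ hW hm hWm hW0 hA hPA
    have hpos : 0 < P.real A := by
      rw [measureReal_def]
      exact ENNReal.toReal_pos hPA (measure_ne_top _ _)
    rw [ProbabilityTheory.cond, integral_smul_measure, ENNReal.toReal_inv, smul_eq_mul, abs_mul,
      abs_of_nonneg (by positivity), ← measureReal_def, inv_mul_le_iff₀ hpos] at h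
    linarith

/-- A centered variable bounded by `m` and measurable for `ℬ` has a conditional expectation given
`𝒜` of size at most `2 m φ(𝒜, ℬ)`. -/
theorem abs_condExp_le_phiCoeff [IsProbabilityMeasure P]
    (h𝒜 : 𝒜 ≤ mΩ) (hℬ : ℬ ≤ mΩ) {W : Ω → ℝ} (hW : Measurable[ℬ] W) {m : ℝ} (hm : 0 ≤ m)
    (hWm : ∀ᵐ ω ∂P, |W ω| ≤ m) (hW0 : ∫ ω, W ω ∂P = 0) :
    ∀ᵐ ω ∂P, |(P[W | 𝒜]) ω| ≤ 2 * m * phiCoeff P 𝒜 ℬ := by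
  have hWmΩ : Measurable W := hW.mono hℬ le_rfl
  have hi : Integrable W P := Integrable.of_bound hWmΩ.aestronglyMeasurable m hWm
  have hset : ∀ s, MeasurableSet[𝒜] s →
      ∫ ω in s, (P[W | 𝒜]) ω ∂(P.trim h𝒜) = ∫ ω in s, W ω ∂P := by
    intro s hs
    rw [← setIntegral_trim h𝒜 stronglyMeasurable_condExp hs, setIntegral_condExp h𝒜 hi hs]
  have hint : Integrable (P[W | 𝒜]) (P.trim h𝒜) :=
    integrable_condExp.trim h𝒜 stronglyMeasurable_condExp
  have hc : ∀ c : ℝ, ∀ s, MeasurableSet[𝒜] s → ∫ _ in s, c ∂(P.trim h𝒜) = P.real s * c := by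
    intro c s hs
    rw [← setIntegral_trim h𝒜 stronglyMeasurable_const hs]; simp
  have hup : P[W | 𝒜] ≤ᵐ[P.trim h𝒜] fun _ => 2 * m * phiCoeff P 𝒜 ℬ := by
    refine ae_le_of_forall_setIntegral_le hint (integrable_const _) fun s hs _ => ?_
    rw [hset s hs, hc _ s hs]
    have := (abs_le.1 (abs_setIntegral_le_phiCoeff hℬ hW hm hWm hW0 hs)).2
    linarith
  have hlo : (fun _ => -(2 * m * phiCoeff P 𝒜 ℬ)) ≤ᵐ[P.trim h𝒜] P[W | 𝒜] := by
    refine ae_le_of_forall_setIntegral_le (integrable_const _) hint fun s hs _ => ?_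
    rw [hset s hs, hc _ s hs]
    have := (abs_le.1 (abs_setIntegral_le_phiCoeff hℬ hW hm hWm hW0 hs)).1
    linarith
  filter_upwards [ae_le_of_ae_le_trim hup, ae_le_of_ae_le_trim hlo] with ω h1 h2
  exact abs_le.2 ⟨h2, h1⟩

end Mixing

/-! ### A martingale bound on exponential moments -/

section Martingale

variable {Ω : Type*} {ℱ 𝒢 : MeasurableSpace Ω} [mΩ : MeasurableSpace Ω] {P : Measure Ω}
  [IsProbabilityMeasure P]

/-- One step of the martingale argument: passing from a σ-algebra to a larger one multiplies the
exponential moment of the conditional expectation by at most `exp (c² / 2)`, when the increment is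
bounded by `c`. -/
theorem integral_exp_condExp_le (hℱ𝒢 : ℱ ≤ 𝒢) (h𝒢 : 𝒢 ≤ mΩ)
    {D : Ω → ℝ} {C : ℝ} (hDC : ∀ᵐ ω ∂P, |D ω| ≤ C) {c : ℝ}
    (hc : ∀ᵐ ω ∂P, |(P[D | 𝒢]) ω - (P[D | ℱ]) ω| ≤ c) :
    ∫ ω, Real.exp ((P[D | 𝒢]) ω) ∂P ≤
      Real.exp (c ^ 2 / 2) * ∫ ω, Real.exp ((P[D | ℱ]) ω) ∂P := by
  have hℱ : ℱ ≤ mΩ := hℱ𝒢.trans h𝒢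
  have hbℱ := ae_bdd_abs_condExp_of_ae_bdd_abs (m := ℱ) hDC
  have hb𝒢 := ae_bdd_abs_condExp_of_ae_bdd_abs (m := 𝒢) hDC
  set M := P[D | ℱ] with hM
  set M' := P[D | 𝒢] with hM'
  have hMs : StronglyMeasurable[ℱ] M := stronglyMeasurable_condExp
  have hMs' : StronglyMeasurable M' := stronglyMeasurable_condExp.mono h𝒢
  have heM : StronglyMeasurable[ℱ] (fun ω => Real.exp (M ω)) :=
    Real.continuous_exp.comp_stronglyMeasurable hMs
  have heM' : StronglyMeasurable (fun ω => Real.exp (M' ω)) :=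
    Real.continuous_exp.comp_stronglyMeasurable hMs'
  have hbe : ∀ᵐ ω ∂P, ‖Real.exp (M ω)‖ ≤ Real.exp C := by
    filter_upwards [hbℱ] with ω h
    rw [Real.norm_eq_abs, Real.abs_exp]
    exact Real.exp_le_exp.2 ((abs_le.1 h).2)
  have hie : Integrable (fun ω => Real.exp (M ω)) P :=
    Integrable.of_bound (heM.mono hℱ).aestronglyMeasurable _ hbe
  have hie' : Integrable (fun ω => Real.exp (M' ω)) P := by
    refine Integrable.of_bound heM'.aestronglyMeasurable (Real.exp C) ?_
    filter_upwards [hb𝒢] with ω h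
    rw [Real.norm_eq_abs, Real.abs_exp]
    exact Real.exp_le_exp.2 ((abs_le.1 h).2)
  have hiM' : Integrable M' P := integrable_condExp
  have hiM : Integrable M P := integrable_condExp
  have hieM' : Integrable (fun ω => Real.exp (M ω) * M' ω) P :=
    hiM'.bdd_mul (heM.mono hℱ).aestronglyMeasurable hbe
  have hieM : Integrable (fun ω => Real.exp (M ω) * M ω) P :=
    hiM.bdd_mul (heM.mono hℱ).aestronglyMeasurable hbe
  -- the increment is orthogonal to every bounded function of the past
  have horth : ∫ ω, Real.exp (M ω) * M' ω ∂P = ∫ ω, Real.exp (M ω) * M ω ∂P := by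
    rw [← integral_condExp hℱ (f := fun ω => Real.exp (M ω) * M' ω)]
    refine integral_congr_ae ?_
    have h1 := condExp_mul_of_stronglyMeasurable_left (μ := P) heM hieM' hiM'
    have h2 : P[M' | ℱ] =ᵐ[P] M := condExp_condExp_of_le hℱ𝒢 h𝒢
    filter_upwards [h1, h2] with ω e1 e2
    refine Eq.trans e1 ?_
    simp only [Pi.mul_apply, e2]
  have hid : Integrable (fun ω => (Real.exp (M ω) * M' ω - Real.exp (M ω) * M ω) *
      (Real.sinh c / c)) P := (hieM'.sub hieM).mul_const _
  have hpt : ∀ᵐ ω ∂P, Real.exp (M' ω) ≤ Real.exp (M ω) * Real.cosh c +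
      (Real.exp (M ω) * M' ω - Real.exp (M ω) * M ω) * (Real.sinh c / c) := by
    filter_upwards [hc] with ω h
    have hc0 : 0 ≤ c := (abs_nonneg _).trans h
    have hle : |(M' ω - M ω) / c| ≤ 1 := by
      rw [abs_div, abs_of_nonneg hc0]
      exact div_le_one_of_le₀ h hc0
    have hmul : (M' ω - M ω) / c * c = M' ω - M ω := by
      rcases eq_or_lt_of_le hc0 with h0 | h0
      · rw [← h0] at h ⊢
        rw [abs_nonpos_iff.1 h]; simp
      · field_simp
    have := Real.exp_mul_le_cosh_add_mul_sinh hle c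
    rw [hmul] at this
    calc Real.exp (M' ω) = Real.exp (M ω) * Real.exp (M' ω - M ω) := by
          rw [← Real.exp_add]; ring_nf
      _ ≤ Real.exp (M ω) * (Real.cosh c + (M' ω - M ω) / c * Real.sinh c) := by gcongr
      _ = _ := by ring
  calc ∫ ω, Real.exp (M' ω) ∂P
      ≤ ∫ ω, (Real.exp (M ω) * Real.cosh c +
          (Real.exp (M ω) * M' ω - Real.exp (M ω) * M ω) * (Real.sinh c / c)) ∂P :=
        integral_mono_ae hie' ((hie.mul_const _).add hid) hpt
    _ = Real.cosh c * ∫ ω, Real.exp (M ω) ∂P := by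
        rw [integral_add (hie.mul_const _) hid, integral_mul_const,
          integral_mul_const, integral_sub hieM' hieM, horth]
        ring
    _ ≤ _ := by
        gcongr
        exact Real.cosh_le_exp_half_sq c

/-- **Azuma–Hoeffding**: a bounded centered variable, measurable for the last σ-algebra of an
increasing chain, is sub-Gaussian with variance proxy the sum of the squared bounds on the
increments of its conditional expectations. -/
theorem hasSubgaussianMGF_of_condExp_increment (ℱ : ℕ → MeasurableSpace Ω)
    (hmono : Monotone ℱ) (hle : ∀ i, ℱ i ≤ mΩ) (h0 : ℱ 0 = ⊥) {D : Ω → ℝ} {L : ℕ}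
    (hD : Measurable[ℱ L] D) {C : ℝ} (hDC : ∀ᵐ ω ∂P, |D ω| ≤ C) (hD0 : ∫ ω, D ω ∂P = 0)
    {c : ℕ → ℝ} (hc : ∀ i < L, ∀ᵐ ω ∂P, |(P[D | ℱ (i + 1)]) ω - (P[D | ℱ i]) ω| ≤ c i)
    {v : NNReal} (hv : ∑ i ∈ Finset.range L, c i ^ 2 ≤ v) :
    HasSubgaussianMGF D v P := by
  have hDm : Measurable D := hD.mono (hle L) le_rfl
  have hi : Integrable D P := Integrable.of_bound hDm.aestronglyMeasurable C hDC
  have hstep : ∀ t : ℝ, ∀ k ≤ L, ∫ ω, Real.exp ((P[fun ω => t * D ω | ℱ k]) ω) ∂P ≤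
      Real.exp ((∑ i ∈ Finset.range k, c i ^ 2) * t ^ 2 / 2) := by
    intro t k
    induction k with
    | zero =>
      intro _
      rw [h0, condExp_bot, integral_const_mul, hD0]
      simp
    | succ k ih =>
      intro hk
      have hb : ∀ᵐ ω ∂P, |t * D ω| ≤ |t| * C := by
        filter_upwards [hDC] with ω h
        rw [abs_mul]; gcongr
      have hinc : ∀ᵐ ω ∂P, |(P[fun ω => t * D ω | ℱ (k + 1)]) ω -
          (P[fun ω => t * D ω | ℱ k]) ω| ≤ |t| * c k := by
        have e1 := condExp_smul (μ := P) t D (ℱ (k + 1))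
        have e2 := condExp_smul (μ := P) t D (ℱ k)
        filter_upwards [hc k (by omega), e1, e2] with ω h h1 h2
        have h1' : (P[fun ω => t * D ω | ℱ (k + 1)]) ω = t * (P[D | ℱ (k + 1)]) ω := h1
        have h2' : (P[fun ω => t * D ω | ℱ k]) ω = t * (P[D | ℱ k]) ω := h2
        rw [h1', h2', ← mul_sub, abs_mul]
        gcongr
      refine (integral_exp_condExp_le (hmono (Nat.le_succ k)) (hle _) hb hinc).trans ?_
      refine (mul_le_mul_of_nonneg_left (ih (by omega)) (Real.exp_nonneg _)).trans (le_of_eq ?_)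
      rw [← Real.exp_add, Finset.sum_range_succ, mul_pow, sq_abs]
      ring_nf
  refine ⟨fun t => ?_, fun t => ?_⟩
  · refine Integrable.of_bound (Real.measurable_exp.comp (hDm.const_mul t)).aestronglyMeasurable
      (Real.exp (|t| * C)) ?_
    filter_upwards [hDC] with ω h
    rw [Real.norm_eq_abs, Real.abs_exp]
    refine Real.exp_le_exp.2 ((le_abs_self _).trans ?_)
    rw [abs_mul]; gcongr
  · have h := hstep t L le_rfl
    rw [condExp_of_stronglyMeasurable (hle L) (hD.const_mul t).stronglyMeasurable
      (hi.const_mul t)] at h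
    refine h.trans (Real.exp_le_exp.2 ?_)
    gcongr

end Martingale

/-! ### Sub-Gaussian bounds for weighted sums of a mixing process -/

/-- **Schur test**: a nonnegative kernel whose row and column sums are at most `Q` has operator norm
at most `Q` on `ℓ²`. -/
theorem sum_sq_sum_mul_le_of_schur {ι κ : Type*} (s : Finset ι) (t : Finset κ) (K : ι → κ → ℝ)
    (hK : ∀ i k, 0 ≤ K i k) {Q : ℝ} (hrow : ∀ i ∈ s, ∑ k ∈ t, K i k ≤ Q)
    (hcol : ∀ k ∈ t, ∑ i ∈ s, K i k ≤ Q) (b : κ → ℝ) :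
    ∑ i ∈ s, (∑ k ∈ t, K i k * b k) ^ 2 ≤ Q ^ 2 * ∑ k ∈ t, b k ^ 2 := by
  rcases s.eq_empty_or_nonempty with rfl | ⟨i₀, hi₀⟩
  · simp only [Finset.sum_empty]; positivity
  have hQ : 0 ≤ Q := (Finset.sum_nonneg fun k _ => hK i₀ k).trans (hrow i₀ hi₀)
  calc ∑ i ∈ s, (∑ k ∈ t, K i k * b k) ^ 2
      ≤ ∑ i ∈ s, (∑ k ∈ t, K i k) * ∑ k ∈ t, K i k * b k ^ 2 :=
        Finset.sum_le_sum fun i _ => Finset.sum_sq_le_sum_mul_sum_of_sq_le_mul _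
          (fun k _ => hK i k) (fun k _ => mul_nonneg (hK i k) (sq_nonneg _))
          (fun k _ => le_of_eq (by ring))
    _ ≤ ∑ i ∈ s, Q * ∑ k ∈ t, K i k * b k ^ 2 := by
        refine Finset.sum_le_sum fun i hi => mul_le_mul_of_nonneg_right (hrow i hi) ?_
        exact Finset.sum_nonneg fun k _ => mul_nonneg (hK i k) (sq_nonneg _)
    _ = Q * ∑ k ∈ t, (∑ i ∈ s, K i k) * b k ^ 2 := by
        rw [← Finset.mul_sum, Finset.sum_comm]
        simp_rw [Finset.sum_mul]
    _ ≤ Q * ∑ k ∈ t, Q * b k ^ 2 := by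
        refine mul_le_mul_of_nonneg_left (Finset.sum_le_sum fun k hk => ?_) hQ
        exact mul_le_mul_of_nonneg_right (hcol k hk) (sq_nonneg _)
    _ = Q ^ 2 * ∑ k ∈ t, b k ^ 2 := by rw [← Finset.mul_sum]; ring

/-- The norm of the upper triangular Toeplitz operator with entries `κ (s - i)`. -/
theorem sum_sq_sum_Ico_mul_le (κ : ℕ → ℝ) (hκ : ∀ r, 0 ≤ κ r) (L : ℕ) (b : ℕ → ℝ) :
    ∑ i ∈ Finset.range L, (∑ s ∈ Finset.Ico i L, κ (s - i) * b s) ^ 2 ≤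
      (∑ r ∈ Finset.range L, κ r) ^ 2 * ∑ s ∈ Finset.range L, b s ^ 2 := by
  have hIco : ∀ i, (Finset.range L).filter (fun s => i ≤ s) = Finset.Ico i L := by
    intro i; ext s; simp [and_comm]
  have h := sum_sq_sum_mul_le_of_schur (Finset.range L) (Finset.range L)
    (fun i s => if i ≤ s then κ (s - i) else 0) (fun i s => by split_ifs; exacts [hκ _, le_rfl])
    (Q := ∑ r ∈ Finset.range L, κ r) ?_ ?_ b
  · refine (Finset.sum_le_sum fun i _ => le_of_eq ?_).trans h
    rw [← hIco i, Finset.sum_filter]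
    simp_rw [ite_mul, zero_mul]
  · intro i _
    rw [← Finset.sum_filter, hIco, Finset.sum_Ico_eq_sum_range]
    simp only [Nat.add_sub_cancel_left]
    exact Finset.sum_le_sum_of_subset_of_nonneg (Finset.range_mono (Nat.sub_le _ _))
      fun r _ _ => hκ r
  · intro s hs
    rw [← Finset.sum_filter]
    have : (Finset.range L).filter (fun i => i ≤ s) = Finset.range (s + 1) := by
      ext i
      have := Finset.mem_range.1 hs
      simp only [Finset.mem_filter, Finset.mem_range]
      omega
    rw [this, Finset.sum_congr rfl (fun i hi => by
      rw [show s - i = s + 1 - 1 - i by omega]), Finset.sum_range_reflect (f := κ)]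
    exact Finset.sum_le_sum_of_subset_of_nonneg
      (Finset.range_mono (Nat.succ_le_of_lt (Finset.mem_range.1 hs))) fun r _ _ => hκ r

theorem hasSubgaussianMGF_mono {Ω : Type*} {mΩ : MeasurableSpace Ω} {P : Measure Ω} {X : Ω → ℝ}
    {c c' : NNReal} (h : HasSubgaussianMGF X c P) (hc : c ≤ c') : HasSubgaussianMGF X c' P :=
  ⟨h.integrable_exp_mul, fun t => (h.mgf_le t).trans (Real.exp_le_exp.2 (by gcongr))⟩

theorem hasSubgaussianMGF_sum_range {Ω : Type*} {mΩ : MeasurableSpace Ω} {P : Measure Ω}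
    [IsProbabilityMeasure P] (X : ℕ → Ω → ℝ) (c : ℕ → NNReal) (N : ℕ)
    (h : ∀ i < N, HasSubgaussianMGF (X i) (c i) P) :
    HasSubgaussianMGF (fun ω => ∑ i ∈ Finset.range N, X i ω)
      ((∑ i ∈ Finset.range N, NNReal.sqrt (c i)) ^ 2) P := by
  induction N with
  | zero => simp
  | succ N ih =>
    have := (ih fun i hi => h i (by omega)).add (h N (by omega))
    simpa [Finset.sum_range_succ] using this

theorem sum_range_mul_eq_sum_sum {M : Type*} [AddCommMonoid M] (f : ℕ → M) (N n : ℕ) :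
    ∑ t ∈ Finset.range (N * n), f t =
      ∑ c ∈ Finset.range N, ∑ i ∈ Finset.range n, f (c * n + i) := by
  induction N with
  | zero => simp
  | succ N ih => rw [Nat.succ_mul, Finset.sum_range_add, ih, Finset.sum_range_succ]

section MixingSums

variable {Ω : Type*}

theorem comap_le_pastSigma (Z : ℤ → Ω → ℝ) {s t : ℤ} (h : s ≤ t) :
    MeasurableSpace.comap (Z s) inferInstance ≤ pastSigma Z t :=
  le_iSup (fun h : Set.Iic t => MeasurableSpace.comap (Z h) inferInstance) ⟨s, h⟩

theorem comap_le_futureSigma (Z : ℤ → Ω → ℝ) {s t : ℤ} (h : t ≤ s) :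
    MeasurableSpace.comap (Z s) inferInstance ≤ futureSigma Z t :=
  le_iSup (fun h : Set.Ici t => MeasurableSpace.comap (Z h) inferInstance) ⟨s, h⟩

theorem pastSigma_mono (Z : ℤ → Ω → ℝ) {s t : ℤ} (h : s ≤ t) : pastSigma Z s ≤ pastSigma Z t :=
  iSup_le fun u => comap_le_pastSigma Z (u.2.trans h)

/-- The chain `⊥ ≤ σ(Z_h, h ≤ t₀) ≤ σ(Z_h, h ≤ t₀ + 1) ≤ …`. -/
@[reducible] def pastChain (Z : ℤ → Ω → ℝ) (t₀ : ℤ) : ℕ → MeasurableSpace Ω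
  | 0 => ⊥
  | i + 1 => pastSigma Z (t₀ + i)

theorem pastChain_mono (Z : ℤ → Ω → ℝ) (t₀ : ℤ) : Monotone (pastChain Z t₀) := by
  refine monotone_nat_of_le_succ fun i => ?_
  cases i with
  | zero => exact bot_le
  | succ i => exact pastSigma_mono Z (by push_cast; linarith)

theorem measurable_pastChain {Z : ℤ → Ω → ℝ} {t₀ : ℤ} {W : ℕ → Ω → ℝ}
    (hW : ∀ i : ℕ, Measurable[MeasurableSpace.comap (Z (t₀ + i)) inferInstance] (W i))
    {s i : ℕ} (h : s < i) : Measurable[pastChain Z t₀ i] (W s) := by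
  cases i with
  | zero => omega
  | succ i => exact (hW s).mono (comap_le_pastSigma Z (by gcongr; omega)) le_rfl

variable [mΩ : MeasurableSpace Ω] {P : Measure Ω}

theorem pastSigma_le {Z : ℤ → Ω → ℝ} (hZ : ∀ t, Measurable (Z t)) (t : ℤ) : pastSigma Z t ≤ mΩ :=
  iSup_le fun h => (hZ h).comap_le

theorem futureSigma_le {Z : ℤ → Ω → ℝ} (hZ : ∀ t, Measurable (Z t)) (t : ℤ) :
    futureSigma Z t ≤ mΩ :=
  iSup_le fun h => (hZ h).comap_le

theorem pastChain_le {Z : ℤ → Ω → ℝ} (hZ : ∀ t, Measurable (Z t)) (t₀ : ℤ) (i : ℕ) :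
    pastChain Z t₀ i ≤ mΩ := by
  cases i with
  | zero => exact bot_le
  | succ i => exact pastSigma_le hZ _

variable [IsProbabilityMeasure P]

/-- The influence of an observation on another one `r` steps later: `1` for `r = 0`, and otherwise
twice the `φ`-mixing coefficient. -/
noncomputable def mixingKernel (P : Measure Ω) (Z : ℤ → Ω → ℝ) (r : ℕ) : ℝ :=
  if r = 0 then 1 else 2 * phiMixing P Z r

theorem mixingKernel_nonneg (P : Measure Ω) (Z : ℤ → Ω → ℝ) (r : ℕ) : 0 ≤ mixingKernel P Z r := by
  unfold mixingKernel
  split_ifs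
  · exact zero_le_one
  · have := phiMixing_nonneg P Z r; positivity

theorem sum_mixingKernel_le (Z : ℤ → Ω → ℝ) {L n : ℕ} (hL : L ≤ n + 1) :
    ∑ r ∈ Finset.range L, mixingKernel P Z r ≤ 2 * mixingSum P Z n := by
  calc ∑ r ∈ Finset.range L, mixingKernel P Z r
      ≤ ∑ r ∈ Finset.range (n + 1), mixingKernel P Z r :=
        Finset.sum_le_sum_of_subset_of_nonneg (Finset.range_mono hL)
          fun r _ _ => mixingKernel_nonneg P Z r
    _ = 1 + ∑ r ∈ Finset.Icc 1 n, mixingKernel P Z r := by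
        rw [Finset.range_eq_Ico, Finset.sum_eq_sum_Ico_succ_bot (by omega)]
        simp [mixingKernel]
        rfl
    _ ≤ 1 + ∑ r ∈ Finset.Icc 1 n, 2 * Real.sqrt (phiMixing P Z r) := by
        gcongr with r hr
        have h1 := Finset.mem_Icc.1 hr
        rw [mixingKernel, if_neg (by omega)]
        gcongr
        refine Real.le_sqrt_of_sq_le ?_
        have h2 := phiMixing_nonneg P Z r
        have h3 := phiMixing_le_one (P := P) Z r
        nlinarith
    _ ≤ 2 * mixingSum P Z n := by
        rw [← Finset.mul_sum, mixingSum]; linarith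

variable {Z : ℤ → Ω → ℝ} {m : ℝ}

theorem abs_condExp_pastChain_le (hZ : ∀ t, Measurable (Z t)) (hm : 0 ≤ m) {t₀ : ℤ} {W : Ω → ℝ} {i s : ℕ} (his : i ≤ s)
    (hW : Measurable[MeasurableSpace.comap (Z (t₀ + s)) inferInstance] W)
    (hWm : ∀ᵐ ω ∂P, |W ω| ≤ m) (hW0 : ∫ ω, W ω ∂P = 0) :
    ∀ᵐ ω ∂P, |(P[W | pastChain Z t₀ (i + 1)]) ω| ≤ mixingKernel P Z (s - i) * m := by
  unfold mixingKernel
  split_ifs with h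
  · simpa using ae_bdd_abs_condExp_of_ae_bdd_abs (m := pastChain Z t₀ (i + 1)) hWm
  · have hW' : Measurable[futureSigma Z (t₀ + i + ((s - i : ℕ) : ℤ))] W :=
      hW.mono (comap_le_futureSigma Z (by push_cast [his]; linarith)) le_rfl
    filter_upwards [abs_condExp_le_phiCoeff (pastSigma_le hZ (t₀ + i)) (futureSigma_le hZ _) hW'
      hm hWm hW0] with ω h
    refine h.trans ?_
    have := mul_le_mul_of_nonneg_left (phiCoeff_le_phiMixing (P := P) Z (t₀ + i) (s - i)) hm
    linarith

/-- The conditional expectation of the tail of a weighted sum, given the chain at the first time of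
the tail or one step later. -/
theorem abs_condExp_tail_le (hZ : ∀ t, Measurable (Z t)) (hm : 0 ≤ m) {t₀ : ℤ} {W : ℕ → Ω → ℝ}
    (hW : ∀ i : ℕ, Measurable[MeasurableSpace.comap (Z (t₀ + i)) inferInstance] (W i))
    (hWm : ∀ i, ∀ᵐ ω ∂P, |W i ω| ≤ m) (hW0 : ∀ i, ∫ ω, W i ω ∂P = 0) (b : ℕ → ℝ) (L i j : ℕ)
    (hj : j ≤ i + 1) :
    ∀ᵐ ω ∂P, |(P[fun ω => ∑ s ∈ Finset.Ico i L, b s * W s ω | pastChain Z t₀ j]) ω| ≤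
      m * ∑ s ∈ Finset.Ico i L, mixingKernel P Z (s - i) * |b s| := by
  have hWmeas : ∀ s, Measurable (W s) := fun s => (hW s).mono (hZ _).comap_le le_rfl
  have hWi : ∀ s, Integrable (W s) P := fun s =>
    Integrable.of_bound (hWmeas s).aestronglyMeasurable m (hWm s)
  have hfun : (fun ω => ∑ s ∈ Finset.Ico i L, b s * W s ω) =
      ∑ s ∈ Finset.Ico i L, b s • W s := by
    ext ω; simp
  have hlast : ∀ᵐ ω ∂P, |(P[fun ω => ∑ s ∈ Finset.Ico i L, b s * W s ω |
      pastChain Z t₀ (i + 1)]) ω| ≤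
        m * ∑ s ∈ Finset.Ico i L, mixingKernel P Z (s - i) * |b s| := by
    have h1 := condExp_finsetSum (μ := P) (s := Finset.Ico i L) (f := fun s => b s • W s)
      (fun s _ => (hWi s).smul (b s)) (pastChain Z t₀ (i + 1))
    have h2 : ∀ᵐ ω ∂P, ∀ s ∈ Finset.Ico i L, (P[b s • W s | pastChain Z t₀ (i + 1)]) ω =
        b s * (P[W s | pastChain Z t₀ (i + 1)]) ω := by
      rw [Filter.eventually_all_finset]
      intro s _
      filter_upwards [condExp_smul (μ := P) (b s) (W s) (pastChain Z t₀ (i + 1))] with ω h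
      exact h
    have h3 : ∀ᵐ ω ∂P, ∀ s ∈ Finset.Ico i L, |(P[W s | pastChain Z t₀ (i + 1)]) ω| ≤
        mixingKernel P Z (s - i) * m := by
      rw [Filter.eventually_all_finset]
      intro s hs
      exact abs_condExp_pastChain_le hZ hm (Finset.mem_Ico.1 hs).1 (hW s) (hWm s) (hW0 s)
    rw [hfun]
    filter_upwards [h1, h2, h3] with ω e1 e2 e3
    rw [e1, Finset.sum_apply, Finset.mul_sum]
    refine (Finset.abs_sum_le_sum_abs _ _).trans (Finset.sum_le_sum fun s hs => ?_)
    rw [e2 s hs, abs_mul]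
    have := mul_le_mul_of_nonneg_left (e3 s hs) (abs_nonneg (b s))
    linarith
  have htower := condExp_condExp_of_le (μ := P)
    (f := fun ω => ∑ s ∈ Finset.Ico i L, b s * W s ω) (pastChain_mono Z t₀ hj)
    (pastChain_le hZ t₀ (i + 1))
  filter_upwards [htower, ae_bdd_abs_condExp_of_ae_bdd_abs (m := pastChain Z t₀ j) hlast]
    with ω e h
  rwa [e] at h

/-- A weighted sum of at most `n + 1` consecutive bounded centered observations is sub-Gaussian; its
variance proxy is that of independent observations up to the factor `16 Φ²`. -/
theorem hasSubgaussianMGF_block (hZ : ∀ t, Measurable (Z t)) (hm : 0 ≤ m) {t₀ : ℤ}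
    {W : ℕ → Ω → ℝ}
    (hW : ∀ i : ℕ, Measurable[MeasurableSpace.comap (Z (t₀ + i)) inferInstance] (W i))
    (hWm : ∀ i, ∀ᵐ ω ∂P, |W i ω| ≤ m) (hW0 : ∀ i, ∫ ω, W i ω ∂P = 0) (b : ℕ → ℝ) {L n : ℕ}
    (hL : L ≤ n + 1) {v : NNReal}
    (hv : 16 * m ^ 2 * mixingSum P Z n ^ 2 * ∑ i ∈ Finset.range L, b i ^ 2 ≤ v) :
    HasSubgaussianMGF (fun ω => ∑ i ∈ Finset.range L, b i * W i ω) v P := by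
  have hWmeas : ∀ s, Measurable (W s) := fun s => (hW s).mono (hZ _).comap_le le_rfl
  have hWi : ∀ s, Integrable (W s) P := fun s =>
    Integrable.of_bound (hWmeas s).aestronglyMeasurable m (hWm s)
  have hsub : ∀ (s : Finset ℕ) (i : ℕ), (∀ j ∈ s, j < i) →
      Measurable[pastChain Z t₀ i] (fun ω => ∑ j ∈ s, b j * W j ω) := fun s i h =>
    Finset.measurable_sum _ fun j hj => (measurable_pastChain hW (h j hj)).const_mul _
  have hint : ∀ s : Finset ℕ, Integrable (fun ω => ∑ j ∈ s, b j * W j ω) P := fun s =>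
    integrable_finsetSum _ fun j _ => (hWi j).const_mul _
  refine hasSubgaussianMGF_of_condExp_increment (pastChain Z t₀) (pastChain_mono Z t₀)
    (pastChain_le hZ t₀) rfl (hsub _ L fun j hj => Finset.mem_range.1 hj)
    (C := ∑ i ∈ Finset.range L, |b i| * m) ?_ ?_
    (c := fun i => 2 * (m * ∑ s ∈ Finset.Ico i L, mixingKernel P Z (s - i) * |b s|)) ?_ ?_
  · filter_upwards [ae_all_iff.2 hWm] with ω h
    refine (Finset.abs_sum_le_sum_abs _ _).trans (Finset.sum_le_sum fun s _ => ?_)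
    rw [abs_mul]
    exact mul_le_mul_of_nonneg_left (h s) (abs_nonneg _)
  · rw [integral_finsetSum _ fun j _ => (hWi j).const_mul _]
    simp [integral_const_mul, hW0]
  · intro i hi
    -- the head of the sum is known at time `i`, and cancels in the increment
    have hsplit : (fun ω => ∑ s ∈ Finset.range L, b s * W s ω) =
        (fun ω => ∑ s ∈ Finset.range i, b s * W s ω) +
          (fun ω => ∑ s ∈ Finset.Ico i L, b s * W s ω) := by
      ext ω
      rw [Pi.add_apply, Finset.range_eq_Ico, Finset.range_eq_Ico,
        Finset.sum_Ico_consecutive _ (Nat.zero_le i) hi.le]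
    have hhead : ∀ j, i ≤ j → P[fun ω => ∑ s ∈ Finset.range L, b s * W s ω | pastChain Z t₀ j]
        =ᵐ[P] (fun ω => ∑ s ∈ Finset.range i, b s * W s ω) +
          P[fun ω => ∑ s ∈ Finset.Ico i L, b s * W s ω | pastChain Z t₀ j] := by
      intro j hj
      have h1 := condExp_add (hint (Finset.range i)) (hint (Finset.Ico i L)) (pastChain Z t₀ j)
      rw [hsplit]
      refine h1.trans ?_
      rw [condExp_of_stronglyMeasurable (pastChain_le hZ t₀ j)
        (hsub _ j fun s hs => (Finset.mem_range.1 hs).trans_le hj).stronglyMeasurable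
        (hint (Finset.range i))]
    filter_upwards [hhead i le_rfl, hhead (i + 1) (Nat.le_succ i),
      abs_condExp_tail_le hZ hm hW hWm hW0 b L i i (Nat.le_succ i),
      abs_condExp_tail_le hZ hm hW hWm hW0 b L i (i + 1) le_rfl] with ω e1 e2 h1 h2
    rw [e1, e2, Pi.add_apply, Pi.add_apply, add_sub_add_left_eq_sub, two_mul]
    exact (abs_sub _ _).trans (add_le_add h2 h1)
  · refine le_trans ?_ hv
    have h1 := sum_sq_sum_Ico_mul_le (mixingKernel P Z) (mixingKernel_nonneg P Z) L (fun s => |b s|)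
    simp only [sq_abs] at h1
    have h2 := sum_mixingKernel_le (P := P) Z hL
    have h3 : 0 ≤ ∑ r ∈ Finset.range L, mixingKernel P Z r :=
      Finset.sum_nonneg fun r _ => mixingKernel_nonneg P Z r
    have h4 : 0 ≤ ∑ s ∈ Finset.range L, b s ^ 2 := Finset.sum_nonneg fun s _ => sq_nonneg _
    calc ∑ i ∈ Finset.range L,
          (2 * (m * ∑ s ∈ Finset.Ico i L, mixingKernel P Z (s - i) * |b s|)) ^ 2
        = 4 * m ^ 2 * ∑ i ∈ Finset.range L,
          (∑ s ∈ Finset.Ico i L, mixingKernel P Z (s - i) * |b s|) ^ 2 := by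
          rw [Finset.mul_sum]
          exact Finset.sum_congr rfl fun i _ => by ring
      _ ≤ 4 * m ^ 2 * ((2 * mixingSum P Z n) ^ 2 * ∑ s ∈ Finset.range L, b s ^ 2) := by
          refine mul_le_mul_of_nonneg_left (h1.trans ?_) (by positivity)
          gcongr
      _ = _ := by ring

/-- Only the first `n` mixing coefficients enter `Φ`, so a long row is cut into `N` blocks of length
`n`, between which no dependence information is used. -/
theorem hasSubgaussianMGF_row (hZ : ∀ t, Measurable (Z t)) (hm : 0 ≤ m) {T N n : ℕ}
    (hT : T ≤ N * n) (hZm : ∀ t : Fin T, ∀ᵐ ω ∂P, |Z (((t : ℕ) : ℤ) + 1) ω| ≤ m)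
    (hZ0 : ∀ t : Fin T, ∫ ω, Z (((t : ℕ) : ℤ) + 1) ω ∂P = 0) (b : Fin T → ℝ) {v : NNReal}
    (hv : 16 * m ^ 2 * mixingSum P Z n ^ 2 * N * ∑ t, b t ^ 2 ≤ v) :
    HasSubgaussianMGF (fun ω => ∑ t, b t * Z (((t : ℕ) : ℤ) + 1) ω) v P := by
  set b' : ℕ → ℝ := fun t => if h : t < T then b ⟨t, h⟩ else 0 with hb'
  set W : ℕ → Ω → ℝ := fun t => if t < T then Z ((t : ℤ) + 1) else fun _ => 0 with hWdef
  have hext : ∀ g : ℕ → ℝ, (∀ t, T ≤ t → g t = 0) →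
      ∑ t ∈ Finset.range (N * n), g t = ∑ t : Fin T, g t := by
    intro g hg
    rw [← Fin.sum_univ_eq_sum_range, Fin.sum_univ_eq_sum_range g T,
      Fin.sum_univ_eq_sum_range g (N * n)]
    refine (Finset.sum_subset (Finset.range_mono hT) fun t _ ht => hg t ?_).symm
    simpa using ht
  have hWmeas : ∀ (c : ℕ) (i : ℕ), Measurable[MeasurableSpace.comap
      (Z (((c * n : ℕ) : ℤ) + 1 + i)) inferInstance] (W (c * n + i)) := by
    intro c i
    simp only [hWdef]
    split_ifs
    · rw [show (((c * n + i : ℕ) : ℤ) + 1) = ((c * n : ℕ) : ℤ) + 1 + i by push_cast; ring]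
      exact comap_measurable _
    · exact measurable_const
  have hWm : ∀ t, ∀ᵐ ω ∂P, |W t ω| ≤ m := by
    intro t
    simp only [hWdef]
    split_ifs with h
    · exact hZm ⟨t, h⟩
    · simpa using hm
  have hW0 : ∀ t, ∫ ω, W t ω ∂P = 0 := by
    intro t
    simp only [hWdef]
    split_ifs with h
    · exact hZ0 ⟨t, h⟩
    · simp
  set q : ℕ → NNReal := fun c => Real.toNNReal (16 * m ^ 2 * mixingSum P Z n ^ 2 *
    ∑ i ∈ Finset.range n, b' (c * n + i) ^ 2) with hq
  have hblock : ∀ c < N, HasSubgaussianMGF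
      (fun ω => ∑ i ∈ Finset.range n, b' (c * n + i) * W (c * n + i) ω) (q c) P := fun c _ =>
    hasSubgaussianMGF_block hZ hm (hWmeas c) (fun i => hWm _) (fun i => hW0 _)
      (fun i => b' (c * n + i)) (Nat.le_succ n) (Real.le_coe_toNNReal _)
  have hsum := hasSubgaussianMGF_sum_range _ q N hblock
  have hfun : (fun ω => ∑ c ∈ Finset.range N,
      ∑ i ∈ Finset.range n, b' (c * n + i) * W (c * n + i) ω) =
        fun ω => ∑ t, b t * Z (((t : ℕ) : ℤ) + 1) ω := by
    ext ω
    rw [← sum_range_mul_eq_sum_sum (fun t => b' t * W t ω), hext]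
    · refine Finset.sum_congr rfl fun t _ => ?_
      simp [hb', hWdef]
    · intro t ht
      simp [hb', not_lt.2 ht]
  rw [hfun] at hsum
  refine hasSubgaussianMGF_mono hsum ?_
  rw [← NNReal.coe_le_coe]
  refine le_trans ?_ hv
  have hqc : ∀ c, (q c : ℝ) = 16 * m ^ 2 * mixingSum P Z n ^ 2 *
      ∑ i ∈ Finset.range n, b' (c * n + i) ^ 2 := fun c => by
    refine Real.coe_toNNReal _ (mul_nonneg (by positivity) (Finset.sum_nonneg fun i _ => ?_))
    exact sq_nonneg _
  push_cast
  calc (∑ c ∈ Finset.range N, Real.sqrt (q c)) ^ 2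
      ≤ N * ∑ c ∈ Finset.range N, Real.sqrt (q c) ^ 2 := by
        simpa using sq_sum_le_card_mul_sum_sq (s := Finset.range N)
          (f := fun c => Real.sqrt (q c))
    _ = N * ∑ c ∈ Finset.range N, 16 * m ^ 2 * mixingSum P Z n ^ 2 *
          ∑ i ∈ Finset.range n, b' (c * n + i) ^ 2 := by
        congr 1
        refine Finset.sum_congr rfl fun c _ => ?_
        rw [Real.sq_sqrt (NNReal.coe_nonneg (q c)), hqc]
    _ = 16 * m ^ 2 * mixingSum P Z n ^ 2 * N * ∑ t, b t ^ 2 := by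
        rw [← Finset.mul_sum, ← sum_range_mul_eq_sum_sum (fun t => b' t ^ 2), hext]
        · simp only [hb', Fin.is_lt, dite_true]
          ring
        · intro t ht
          simp [hb', not_lt.2 ht]
    _ ≤ _ := le_rfl

end MixingSums

/-! ### Exponential moments under Bernstein's moment condition -/

section Bernstein

variable {Ω : Type*} [MeasurableSpace Ω] {P : Measure Ω} {ξ : Ω → ℝ} {v c : ℝ}

theorem integral_abs_pow_le
    (hξ2 : Integrable (fun ω => ξ ω ^ 2) P ∧ ∫ ω, ξ ω ^ 2 ∂P ≤ v)
    (hξq : ∀ q : ℕ, 3 ≤ q → Integrable (fun ω => |ξ ω| ^ q) P ∧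
      ∫ ω, |ξ ω| ^ q ∂P ≤ v * c ^ (q - 2) * (Nat.factorial q : ℝ) / 2) (q : ℕ) :
    Integrable (fun ω => |ξ ω| ^ (q + 2)) P ∧
      ∫ ω, |ξ ω| ^ (q + 2) ∂P ≤ v * c ^ q * (Nat.factorial (q + 2) : ℝ) / 2 := by
  rcases q with _ | q
  · simp only [zero_add, sq_abs, pow_zero, mul_one]
    refine ⟨hξ2.1, hξ2.2.trans (le_of_eq ?_)⟩
    norm_num [Nat.factorial]
  · exact hξq (q + 1 + 2) (by omega)

variable [IsProbabilityMeasure P]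

theorem integrable_of_integrable_sq (hξm : Measurable ξ)
    (hξ2 : Integrable (fun ω => ξ ω ^ 2) P) : Integrable ξ P := by
  refine (hξ2.add (integrable_const 1)).mono' hξm.aestronglyMeasurable ?_
  refine Filter.Eventually.of_forall fun ω => ?_
  rw [Real.norm_eq_abs, Pi.add_apply, ← sq_abs]
  nlinarith [sq_nonneg (|ξ ω| - 1), abs_nonneg (ξ ω)]

/-- The exponential series of `a |ξ|` is integrated term by term; from the quadratic term on it is
dominated by a geometric series of ratio `a c ≤ 1 / 2`. -/
theorem integral_exp_mul_abs_le (hξm : Measurable ξ)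
    (hξ2 : Integrable (fun ω => ξ ω ^ 2) P ∧ ∫ ω, ξ ω ^ 2 ∂P ≤ v)
    (hξq : ∀ q : ℕ, 3 ≤ q → Integrable (fun ω => |ξ ω| ^ q) P ∧
      ∫ ω, |ξ ω| ^ q ∂P ≤ v * c ^ (q - 2) * (Nat.factorial q : ℝ) / 2)
    (hv : 0 ≤ v) (hc : 0 ≤ c) {a : ℝ} (ha : 0 ≤ a) (hac : a * c ≤ 1 / 2) :
    Integrable (fun ω => Real.exp (a * |ξ ω|)) P ∧
      ∫ ω, Real.exp (a * |ξ ω|) ∂P ≤ 1 + a * ∫ ω, |ξ ω| ∂P + a ^ 2 * v := by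
  have hξ1 : Integrable (fun ω => |ξ ω|) P := (integrable_of_integrable_sq hξm hξ2.1).abs
  set F : ℕ → Ω → ℝ := fun q ω => (a * |ξ ω|) ^ q / (Nat.factorial q : ℝ) with hF
  have hFq : ∀ q, F q = fun ω => a ^ q / (Nat.factorial q : ℝ) * |ξ ω| ^ q := by
    intro q; ext ω; simp only [hF, mul_pow]; ring
  have hFnn : ∀ q ω, 0 ≤ F q ω := fun q ω => by simp only [hF]; positivity
  have hFint : ∀ q, Integrable (F q) P := by
    intro q
    rw [hFq]
    refine Integrable.const_mul ?_ _
    match q with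
    | 0 => simp
    | 1 => simpa using hξ1
    | q + 2 => exact (integral_abs_pow_le hξ2 hξq q).1
  have hbound : ∀ q, ∫ ω, F (q + 2) ω ∂P ≤ a ^ 2 * v / 2 * (1 / 2) ^ q := by
    intro q
    rw [hFq, integral_const_mul]
    have h := (integral_abs_pow_le hξ2 hξq q).2
    have hfac : (0 : ℝ) < (Nat.factorial (q + 2) : ℝ) := by exact_mod_cast Nat.factorial_pos _
    calc a ^ (q + 2) / (Nat.factorial (q + 2) : ℝ) * ∫ ω, |ξ ω| ^ (q + 2) ∂P
        ≤ a ^ (q + 2) / (Nat.factorial (q + 2) : ℝ) *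
          (v * c ^ q * (Nat.factorial (q + 2) : ℝ) / 2) := by gcongr
      _ = a ^ 2 * v / 2 * (a * c) ^ q := by rw [mul_pow]; field_simp; ring
      _ ≤ _ := by gcongr
  have hgeom : HasSum (fun q : ℕ => a ^ 2 * v / 2 * (1 / 2 : ℝ) ^ q) (a ^ 2 * v) := by
    have := hasSum_geometric_two.mul_left (a ^ 2 * v / 2)
    rwa [div_mul_cancel₀ _ (two_ne_zero)] at this
  have hInn : ∀ q, 0 ≤ ∫ ω, F q ω ∂P := fun q => integral_nonneg (hFnn q)
  have hsummable2 : Summable fun q => ∫ ω, F (q + 2) ω ∂P :=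
    Summable.of_nonneg_of_le (fun q => hInn _) hbound hgeom.summable
  have hsummable : Summable fun q => ∫ ω, F q ω ∂P := (summable_nat_add_iff 2).1 hsummable2
  have hexp : (fun ω => ∑' q, F q ω) = fun ω => Real.exp (a * |ξ ω|) := by
    ext ω
    rw [Real.exp_eq_exp_ℝ]
    exact (NormedSpace.expSeries_div_hasSum_exp (a * |ξ ω|)).tsum_eq
  have hsum : HasSum (fun q => ∫ ω, F q ω ∂P) (∫ ω, Real.exp (a * |ξ ω|) ∂P) := by
    rw [← hexp]
    refine hasSum_integral_of_summable_integral_norm hFint ?_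
    simpa only [Real.norm_of_nonneg (hFnn _ _)] using hsummable
  have hF0 : ∫ ω, F 0 ω ∂P = 1 := by simp [hF]
  have hF1 : ∫ ω, F 1 ω ∂P = a * ∫ ω, |ξ ω| ∂P := by
    rw [← integral_const_mul]; simp [hF]
  refine ⟨?_, ?_⟩
  · -- a non-integrable function would have integral `0`, below the zeroth term of the series
    by_contra hni
    have h1 := le_hasSum hsum 0 fun q _ => hInn q
    rw [hF0, integral_undef hni] at h1
    linarith
  · rw [← hsum.tsum_eq, ← hsummable.sum_add_tsum_nat_add 2, Finset.sum_range_succ,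
      Finset.sum_range_one, hF0, hF1]
    have := hsummable2.tsum_le_tsum hbound hgeom.summable
    rw [hgeom.tsum_eq] at this
    linarith

theorem exp_le_exp_abs_sub_abs_add (x : ℝ) : Real.exp x ≤ Real.exp |x| - |x| + x := by
  rcases le_total 0 x with h | h
  · rw [abs_of_nonneg h]; linarith
  · rw [abs_of_nonpos h]
    have := Real.self_le_sinh_iff.2 (neg_nonneg.2 h)
    rw [Real.sinh_eq, neg_neg] at this
    linarith

theorem lintegral_exp_mul_le_of_centered (hξm : Measurable ξ) (hξ0 : ∫ ω, ξ ω ∂P = 0)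
    (hξ2 : Integrable (fun ω => ξ ω ^ 2) P ∧ ∫ ω, ξ ω ^ 2 ∂P ≤ v)
    (hξq : ∀ q : ℕ, 3 ≤ q → Integrable (fun ω => |ξ ω| ^ q) P ∧
      ∫ ω, |ξ ω| ^ q ∂P ≤ v * c ^ (q - 2) * (Nat.factorial q : ℝ) / 2)
    (hv : 0 ≤ v) (hc : 0 ≤ c) {a : ℝ} (hac : |a| * c ≤ 1 / 2) :
    ∫⁻ ω, ENNReal.ofReal (Real.exp (a * ξ ω)) ∂P ≤ ENNReal.ofReal (Real.exp (a ^ 2 * v)) := by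
  obtain ⟨hi, hle⟩ := integral_exp_mul_abs_le hξm hξ2 hξq hv hc (abs_nonneg a) hac
  have hξi : Integrable ξ P := integrable_of_integrable_sq hξm hξ2.1
  have hi1 : Integrable (fun ω => |a| * |ξ ω|) P := hξi.abs.const_mul _
  have hi2 : Integrable (fun ω => a * ξ ω) P := hξi.const_mul _
  have hi3 : Integrable (fun ω => Real.exp (|a| * |ξ ω|) - |a| * |ξ ω|) P := hi.sub hi1
  have hi4 : Integrable (fun ω => Real.exp (|a| * |ξ ω|) - |a| * |ξ ω| + a * ξ ω) P := hi3.add hi2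
  calc ∫⁻ ω, ENNReal.ofReal (Real.exp (a * ξ ω)) ∂P
      ≤ ∫⁻ ω, ENNReal.ofReal (Real.exp (|a| * |ξ ω|) - |a| * |ξ ω| + a * ξ ω) ∂P := by
        refine lintegral_mono fun ω => ENNReal.ofReal_le_ofReal ?_
        simpa only [abs_mul] using exp_le_exp_abs_sub_abs_add (a * ξ ω)
    _ = ENNReal.ofReal (∫ ω, (Real.exp (|a| * |ξ ω|) - |a| * |ξ ω| + a * ξ ω) ∂P) := by
        rw [ofReal_integral_eq_lintegral_ofReal hi4]
        refine Filter.Eventually.of_forall fun ω => ?_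
        have := exp_le_exp_abs_sub_abs_add (a * ξ ω)
        rw [abs_mul] at this
        exact (Real.exp_nonneg _).trans this
    _ ≤ ENNReal.ofReal (Real.exp (a ^ 2 * v)) := by
        refine ENNReal.ofReal_le_ofReal ?_
        have e1 : ∫ ω, (Real.exp (|a| * |ξ ω|) - |a| * |ξ ω| + a * ξ ω) ∂P =
            ∫ ω, Real.exp (|a| * |ξ ω|) ∂P - |a| * ∫ ω, |ξ ω| ∂P + a * ∫ ω, ξ ω ∂P := by
          rw [← integral_const_mul, ← integral_const_mul, ← integral_sub hi hi1,
            ← integral_add hi3 hi2]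
        rw [e1, hξ0]
        rw [sq_abs] at hle
        have := Real.add_one_le_exp (a ^ 2 * v)
        linarith

/-- The exponent `u` is such that both the standard deviation and the scale `c` are at most of order
`1 / u`. -/
theorem lintegral_exp_mul_abs_le (hξm : Measurable ξ)
    (hξ2 : Integrable (fun ω => ξ ω ^ 2) P ∧ ∫ ω, ξ ω ^ 2 ∂P ≤ v)
    (hξq : ∀ q : ℕ, 3 ≤ q → Integrable (fun ω => |ξ ω| ^ q) P ∧
      ∫ ω, |ξ ω| ^ q ∂P ≤ v * c ^ (q - 2) * (Nat.factorial q : ℝ) / 2)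
    (hv : 0 ≤ v) (hc : 0 ≤ c) {u : ℝ} (hu : 0 ≤ u) (huc : u * c ≤ 1 / 2) (huv : u ^ 2 * v ≤ 1) :
    ∫⁻ ω, ENNReal.ofReal (Real.exp (u * |ξ ω|)) ∂P ≤ ENNReal.ofReal (Real.exp 2) := by
  obtain ⟨hi, hle⟩ := integral_exp_mul_abs_le hξm hξ2 hξq hv hc hu huc
  rw [← ofReal_integral_eq_lintegral_ofReal hi
    (Filter.Eventually.of_forall fun ω => Real.exp_nonneg _)]
  refine ENNReal.ofReal_le_ofReal ?_
  have hξi : Integrable ξ P := integrable_of_integrable_sq hξm hξ2.1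
  have h1 : u * ∫ ω, |ξ ω| ∂P ≤ (1 + u ^ 2 * ∫ ω, ξ ω ^ 2 ∂P) / 2 := by
    rw [← integral_const_mul]
    calc ∫ ω, u * |ξ ω| ∂P ≤ ∫ ω, (1 / 2 + u ^ 2 / 2 * ξ ω ^ 2) ∂P := by
          refine integral_mono (hξi.abs.const_mul _)
            ((integrable_const _).add (hξ2.1.const_mul _)) fun ω => ?_
          simp only
          rw [← sq_abs (ξ ω)]
          nlinarith [sq_nonneg (u * |ξ ω| - 1)]
      _ = _ := by
          rw [integral_add (integrable_const _) (hξ2.1.const_mul _), integral_const_mul]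
          simp
          ring
  have h2 : u ^ 2 * ∫ ω, ξ ω ^ 2 ∂P ≤ u ^ 2 * v :=
    mul_le_mul_of_nonneg_left hξ2.2 (sq_nonneg u)
  have h3 := Real.add_one_le_exp (2 : ℝ)
  linarith

end Bernstein

/-! ### Sampling one entry of a matrix -/

section Design

instance instMeasurableSingletonClassMatrix {m p : ℕ} {R : Type*} [MeasurableSpace R]
    [MeasurableSingletonClass R] : MeasurableSingletonClass (Matrix (Fin m) (Fin p) R) :=
  inferInstanceAs (MeasurableSingletonClass (Fin m → Fin p → R))

variable {d T : ℕ}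

theorem measurable_matrix_entry (j : Fin d) (t : Fin T) :
    Measurable fun X : Matrix (Fin d) (Fin T) ℝ => X j t :=
  (measurable_pi_apply t).comp (measurable_pi_apply (X := fun _ : Fin d => Fin T → ℝ) j)

/-- The Frobenius product of two real matrices. -/
def realInner (X e : Matrix (Fin d) (Fin T) ℝ) : ℝ := ∑ j, ∑ t, X j t * e j t

theorem frobInner_toComplex (X e : Matrix (Fin d) (Fin T) ℝ) :
    frobInner X (toComplex e) = (realInner X e : ℂ) := by
  simp [frobInner, toComplex, realInner]

theorem frobInner_add (X : Matrix (Fin d) (Fin T) ℝ) (A B : Matrix (Fin d) (Fin T) ℂ) :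
    frobInner X (A + B) = frobInner X A + frobInner X B := by
  simp [frobInner, mul_add, Finset.sum_add_distrib]

theorem frobInner_sub (X : Matrix (Fin d) (Fin T) ℝ) (A B : Matrix (Fin d) (Fin T) ℂ) :
    frobInner X (A - B) = frobInner X A - frobInner X B := by
  simp [frobInner, mul_sub, Finset.sum_sub_distrib]

theorem frobInner_single (j : Fin d) (t : Fin T) (A : Matrix (Fin d) (Fin T) ℂ) :
    frobInner (Matrix.single j t 1) A = A j t := by
  rw [frobInner, Finset.sum_eq_single j, Finset.sum_eq_single t]
  · simp
  · intro b _ hb; simp [Ne.symm hb]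
  · simp
  · intro b _ hb; simp [Ne.symm hb]
  · simp

theorem realInner_single (j : Fin d) (t : Fin T) (e : Matrix (Fin d) (Fin T) ℝ) :
    realInner (Matrix.single j t 1) e = e j t := by
  have h := frobInner_single j t (toComplex e)
  rw [frobInner_toComplex] at h
  exact Complex.ofReal_injective h

theorem measurable_frobInner (A : Matrix (Fin d) (Fin T) ℂ) :
    Measurable fun X => frobInner X A := by
  unfold frobInner
  exact Finset.measurable_sum _ fun j _ => Finset.measurable_sum _ fun t _ =>
    (Complex.measurable_ofReal.comp (measurable_matrix_entry j t)).mul_const _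

theorem measurable_realInner :
    Measurable fun p : Matrix (Fin d) (Fin T) ℝ × Matrix (Fin d) (Fin T) ℝ =>
      realInner p.1 p.2 := by
  unfold realInner
  exact Finset.measurable_sum _ fun j _ => Finset.measurable_sum _ fun t _ =>
    ((measurable_matrix_entry j t).comp measurable_fst).mul
      ((measurable_matrix_entry j t).comp measurable_snd)

theorem single_one_injective :
    Function.Injective fun p : Fin d × Fin T => (Matrix.single p.1 p.2 1 : Matrix _ _ ℝ) := by
  rintro ⟨j, t⟩ ⟨j', t'⟩ h
  by_contra hne
  have h1 := congrFun (congrFun h j) t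
  simp only [Matrix.single_apply_same] at h1
  rw [Matrix.single_apply, if_neg] at h1
  · exact one_ne_zero h1
  · rintro ⟨rfl, rfl⟩; exact hne rfl

/-- A law on the matrices `e_j e_t^*` is a finite mixture of point masses. -/
theorem integral_entryMatrices {law : Measure (Matrix (Fin d) (Fin T) ℝ)} [IsFiniteMeasure law]
    (hlaw : ∀ᵐ X ∂law, X ∈ entryMatrices d T) (h : Matrix (Fin d) (Fin T) ℝ → ℝ) :
    ∫ X, h X ∂law = ∑ j, ∑ t, law.real {Matrix.single j t 1} * h (Matrix.single j t 1) := by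
  classical
  set s : Finset (Matrix (Fin d) (Fin T) ℝ) :=
    Finset.univ.image fun p : Fin d × Fin T => Matrix.single p.1 p.2 1 with hs
  have hmem : ∀ᵐ X ∂law, X ∈ (s : Set (Matrix (Fin d) (Fin T) ℝ)) := by
    filter_upwards [hlaw] with X hX
    obtain ⟨j, t, rfl⟩ := hX
    exact Finset.mem_coe.2 (Finset.mem_image.2 ⟨(j, t), Finset.mem_univ _, rfl⟩)
  have hr : law.restrict (s : Set (Matrix (Fin d) (Fin T) ℝ)) = law :=
    Measure.restrict_eq_self_of_ae_mem hmem
  calc ∫ X, h X ∂law = ∫ X in (s : Set (Matrix (Fin d) (Fin T) ℝ)), h X ∂law := by rw [hr]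
    _ = ∑ X ∈ s, law.real {X} • h X := setIntegral_finset s (IntegrableOn.finset)
    _ = _ := by
      rw [hs, Finset.sum_image fun p _ q _ hpq => single_one_injective hpq, Fintype.sum_prod_type]
      rfl

theorem normSqPi_eq_sum {law : Measure (Matrix (Fin d) (Fin T) ℝ)} [IsFiniteMeasure law]
    (hlaw : ∀ᵐ X ∂law, X ∈ entryMatrices d T) (A : Matrix (Fin d) (Fin T) ℂ) :
    normSqPi law A = ∑ j, ∑ t, law.real {Matrix.single j t 1} * ‖A j t‖ ^ 2 := by
  rw [normSqPi, integral_entryMatrices hlaw]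
  simp_rw [frobInner_single]

theorem sum_law_single {law : Measure (Matrix (Fin d) (Fin T) ℝ)} [IsProbabilityMeasure law]
    (hlaw : ∀ᵐ X ∂law, X ∈ entryMatrices d T) :
    ∑ j, ∑ t, law.real {(Matrix.single j t 1 : Matrix (Fin d) (Fin T) ℝ)} = 1 := by
  have := integral_entryMatrices hlaw (fun _ => 1)
  simpa using this.symm

theorem lintegral_entryMatrices_le {Ω : Type*} [MeasurableSpace Ω] {P : Measure Ω}
    {X : Ω → Matrix (Fin d) (Fin T) ℝ} {ξ : Ω → ℝ} (hX : Measurable X) (hξ : Measurable ξ)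
    (hind : IndepFun X ξ P) (hmem : ∀ᵐ ω ∂P, X ω ∈ entryMatrices d T)
    (F : Matrix (Fin d) (Fin T) ℝ → ℝ → ENNReal) (hF : ∀ x, Measurable (F x)) :
    ∫⁻ ω, F (X ω) (ξ ω) ∂P ≤
      ∑ j, ∑ t, P.map X {Matrix.single j t 1} * ∫⁻ ω, F (Matrix.single j t 1) (ξ ω) ∂P := by
  classical
  set I : Fin d → Fin T → Matrix (Fin d) (Fin T) ℝ → ENNReal := fun j t =>
    Set.indicator {Matrix.single j t 1} 1 with hI
  have hIm : ∀ j t, Measurable (I j t) := fun j t =>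
    measurable_one.indicator (measurableSet_singleton _)
  have hmeas : ∀ j t, Measurable fun ω => I j t (X ω) * F (Matrix.single j t 1) (ξ ω) :=
    fun j t => ((hIm j t).comp hX).mul ((hF _).comp hξ)
  calc ∫⁻ ω, F (X ω) (ξ ω) ∂P
      ≤ ∫⁻ ω, ∑ j, ∑ t, I j t (X ω) * F (Matrix.single j t 1) (ξ ω) ∂P := by
        refine lintegral_mono_ae ?_
        filter_upwards [hmem] with ω hω
        obtain ⟨j, t, h⟩ := hω
        calc F (X ω) (ξ ω) = I j t (X ω) * F (Matrix.single j t 1) (ξ ω) := by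
              rw [h]; simp [hI]
          _ ≤ ∑ t, I j t (X ω) * F (Matrix.single j t 1) (ξ ω) :=
              Finset.single_le_sum (f := fun t => I j t (X ω) * F (Matrix.single j t 1) (ξ ω))
                (fun _ _ => zero_le) (Finset.mem_univ t)
          _ ≤ _ := Finset.single_le_sum
                (f := fun j => ∑ t, I j t (X ω) * F (Matrix.single j t 1) (ξ ω))
                (fun _ _ => zero_le) (Finset.mem_univ j)
    _ = ∑ j, ∑ t, ∫⁻ ω, I j t (X ω) * F (Matrix.single j t 1) (ξ ω) ∂P := by
        rw [lintegral_finsetSum _ fun j _ => Finset.measurable_sum _ fun t _ => hmeas j t]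
        refine Finset.sum_congr rfl fun j _ => ?_
        rw [lintegral_finsetSum _ fun t _ => hmeas j t]
    _ = _ := by
        refine Finset.sum_congr rfl fun j _ => Finset.sum_congr rfl fun t _ => ?_
        rw [lintegral_mul_eq_lintegral_mul_lintegral_of_indepFun''
          (f := fun ω => I j t (X ω)) (g := fun ω => F (Matrix.single j t 1) (ξ ω))
          ((hIm j t).comp hX).aemeasurable ((hF _).comp hξ).aemeasurable
          (hind.comp (hIm j t) (hF _)), ← lintegral_map (hIm j t) hX,
          lintegral_indicator_one (measurableSet_singleton _)]

end Design

/-! ### The excess loss of one observation -/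

section ExcessLoss

variable {d T : ℕ}

/-- The loss at an observation `(x, y)` of `Θ + f` minus that of `Θ`, when
`y = ⟨x, Θ + e⟩ + z`. -/
noncomputable def excessLoss (f : Matrix (Fin d) (Fin T) ℂ) (e x : Matrix (Fin d) (Fin T) ℝ)
    (z : ℝ) : ℝ :=
  ‖frobInner x f‖ ^ 2 - 2 * (frobInner x f).re * (realInner x e + z)

/-- `∫ ⟨X, Re f⟩ ⟨X, e⟩ Π(dX)`, for a law `Π` on the matrices `e_j e_t^*`. -/
noncomputable def crossTerm (law : Measure (Matrix (Fin d) (Fin T) ℝ))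
    (f : Matrix (Fin d) (Fin T) ℂ) (e : Matrix (Fin d) (Fin T) ℝ) : ℝ :=
  ∑ j, ∑ t, law.real {Matrix.single j t 1} * (f j t).re * e j t

/-- The step `β` is small in terms of the bound `m0` on the parameters, the bound `mε` on the time
series noise and the moment parameters `v`, `c` of the observation noise. The constant `512` is
`16 * 32`: the first factor comes from `cExp` and `λ^*`, the second one from the choice of `β`. -/
structure IsSmallStep (β m0 mε v c : ℝ) : Prop where
  pos : 0 < β
  m0_pos : 0 < m0
  mε_pos : 0 < mε
  v_pos : 0 < v
  c_pos : 0 < c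
  m0_sq : 512 * β * m0 ^ 2 ≤ 1
  mε_sq : 512 * β * mε ^ 2 ≤ 1
  v_le : 512 * β * v ≤ 1
  m0_c : 512 * β * (m0 * c) ≤ 1

theorem IsSmallStep.exp_le {β m0 mε v c : ℝ} (h : IsSmallStep β m0 mε v c) {s F g e : ℝ}
    (hs : |s| = β) (hF : 0 ≤ F) (hFm : F ≤ 2 * m0) (hg : |g| ≤ F) (he : |e| ≤ mε) :
    Real.exp (s * (F ^ 2 - 2 * g * e) + (-2 * s * g) ^ 2 * v) ≤
      1 + (s * (F ^ 2 - 2 * g * e) + β * F ^ 2 / 8) := by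
  have hβ := h.pos
  have hm0 := h.m0_pos
  have hmε := h.mε_pos
  have hv := h.v_pos
  have h1 := h.m0_sq
  have h2 := h.mε_sq
  have h3 := h.v_le
  have hs2 : s ^ 2 = β ^ 2 := by rw [← hs, sq_abs]
  have hg2 : g ^ 2 ≤ F ^ 2 := by rw [← sq_abs]; gcongr
  have hF2 : F ^ 2 ≤ 4 * m0 ^ 2 := by nlinarith
  set u := s * (F ^ 2 - 2 * g * e) with hu
  set w := (-2 * s * g) ^ 2 * v with hw
  have hw0 : 0 ≤ w := by positivity
  have hwle : w ≤ β * F ^ 2 / 128 := by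
    calc w = 4 * β ^ 2 * v * g ^ 2 := by rw [hw]; linear_combination 4 * v * g ^ 2 * hs2
      _ ≤ 4 * β ^ 2 * v * F ^ 2 := by gcongr
      _ = β * F ^ 2 / 128 * (512 * β * v) := by ring
      _ ≤ β * F ^ 2 / 128 * 1 := by gcongr
      _ = _ := mul_one _
  have hw1 : w ≤ 1 := by
    have : β * F ^ 2 ≤ 1 := by nlinarith
    linarith
  have hab : |F ^ 2 - 2 * g * e| ≤ F * (2 * m0 + 2 * mε) := by
    have h4 : |g * e| ≤ F * mε := by
      rw [abs_mul]; exact mul_le_mul hg he (abs_nonneg _) hF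
    have h5 := abs_le.1 h4
    rw [abs_le]
    constructor <;> nlinarith
  have hu2 : u ^ 2 ≤ β * F ^ 2 / 32 := by
    calc u ^ 2 = β ^ 2 * |F ^ 2 - 2 * g * e| ^ 2 := by rw [hu, sq_abs, mul_pow, hs2]
      _ ≤ β ^ 2 * (F * (2 * m0 + 2 * mε)) ^ 2 := by gcongr
      _ ≤ β ^ 2 * (F ^ 2 * (8 * m0 ^ 2 + 8 * mε ^ 2)) := by
          rw [mul_pow]; gcongr; nlinarith [sq_nonneg (m0 - mε)]
      _ = β * F ^ 2 / 64 * (512 * β * m0 ^ 2 + 512 * β * mε ^ 2) := by ring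
      _ ≤ β * F ^ 2 / 64 * (1 + 1) := by gcongr
      _ = _ := by ring
  have hβF : β * F ^ 2 ≤ 1 / 128 := by nlinarith
  have hle : |u + w| ≤ 1 := by
    rw [← sq_le_one_iff_abs_le_one]
    nlinarith [sq_nonneg (u - w)]
  have hexp := (abs_le.1 (Real.abs_exp_sub_one_sub_id_le hle)).2
  nlinarith [sq_nonneg (u - w)]

theorem measurable_excessLoss (f : Matrix (Fin d) (Fin T) ℂ) :
    Measurable fun p : (Matrix (Fin d) (Fin T) ℝ × ℝ) × Matrix (Fin d) (Fin T) ℝ =>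
      excessLoss f p.2 p.1.1 p.1.2 := by
  unfold excessLoss
  have h1 : Measurable fun p : (Matrix (Fin d) (Fin T) ℝ × ℝ) × Matrix (Fin d) (Fin T) ℝ =>
      frobInner p.1.1 f := (measurable_frobInner f).comp (measurable_fst.comp measurable_fst)
  have h2 : Measurable fun p : (Matrix (Fin d) (Fin T) ℝ × ℝ) × Matrix (Fin d) (Fin T) ℝ =>
      realInner p.1.1 p.2 :=
    measurable_realInner.comp ((measurable_fst.comp measurable_fst).prodMk measurable_snd)
  exact (h1.norm.pow_const 2).sub (((Complex.measurable_re.comp h1).const_mul 2).mul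
    (h2.add (measurable_snd.comp measurable_fst)))

theorem measurable_excessLoss_left (f : Matrix (Fin d) (Fin T) ℂ)
    (e : Matrix (Fin d) (Fin T) ℝ) :
    Measurable fun p : Matrix (Fin d) (Fin T) ℝ × ℝ => excessLoss f e p.1 p.2 := by
  unfold excessLoss
  have h1 : Measurable fun p : Matrix (Fin d) (Fin T) ℝ × ℝ => frobInner p.1 f :=
    (measurable_frobInner f).comp measurable_fst
  have h2 : Measurable fun p : Matrix (Fin d) (Fin T) ℝ × ℝ => realInner p.1 e := by
    unfold realInner
    exact Finset.measurable_sum _ fun j _ => Finset.measurable_sum _ fun t _ =>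
      ((measurable_matrix_entry j t).comp measurable_fst).mul_const _
  exact (h1.norm.pow_const 2).sub (((Complex.measurable_re.comp h1).const_mul 2).mul
    (h2.add measurable_snd))

theorem measurable_excessLoss_right (f : Matrix (Fin d) (Fin T) ℂ)
    (e x : Matrix (Fin d) (Fin T) ℝ) : Measurable fun z : ℝ => excessLoss f e x z := by
  unfold excessLoss
  fun_prop

theorem lintegral_exp_excessLoss_single_le {Ω : Type*} [MeasurableSpace Ω] {P : Measure Ω}
    [IsProbabilityMeasure P] {ξ : Ω → ℝ} (hξm : Measurable ξ)
    {m0 mε v c β : ℝ} (hβ : IsSmallStep β m0 mε v c) (hξ0 : ∫ ω, ξ ω ∂P = 0)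
    (hξ2 : Integrable (fun ω => ξ ω ^ 2) P ∧ ∫ ω, ξ ω ^ 2 ∂P ≤ v)
    (hξq : ∀ q : ℕ, 3 ≤ q → Integrable (fun ω => |ξ ω| ^ q) P ∧
      ∫ ω, |ξ ω| ^ q ∂P ≤ v * c ^ (q - 2) * (Nat.factorial q : ℝ) / 2)
    {f : Matrix (Fin d) (Fin T) ℂ} (hf : ∀ j t, ‖f j t‖ ≤ 2 * m0)
    {e : Matrix (Fin d) (Fin T) ℝ} (he : ∀ j t, |e j t| ≤ mε) {s : ℝ} (hs : |s| = β)
    (j : Fin d) (t : Fin T) :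
    ∫⁻ ω, ENNReal.ofReal (Real.exp (s * excessLoss f e (Matrix.single j t 1) (ξ ω))) ∂P ≤
      ENNReal.ofReal (1 + (s * (‖f j t‖ ^ 2 - 2 * (f j t).re * e j t) +
        β * ‖f j t‖ ^ 2 / 8)) := by
  have hre := Complex.abs_re_le_norm (f j t)
  have hsplit : ∀ ω, ENNReal.ofReal
      (Real.exp (s * excessLoss f e (Matrix.single j t 1) (ξ ω))) =
      ENNReal.ofReal (Real.exp (s * (‖f j t‖ ^ 2 - 2 * (f j t).re * e j t))) *
        ENNReal.ofReal (Real.exp ((-2 * s * (f j t).re) * ξ ω)) := by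
    intro ω
    rw [← ENNReal.ofReal_mul (Real.exp_nonneg _), ← Real.exp_add, excessLoss, frobInner_single,
      realInner_single]
    ring_nf
  have hac : |-2 * s * (f j t).re| * c ≤ 1 / 2 := by
    have h1 := hβ.m0_c
    have h2 := hβ.c_pos
    have h3 := hβ.pos
    have h4 : |-2 * s * (f j t).re| ≤ 2 * β * (2 * m0) := by
      rw [abs_mul, abs_mul, hs, abs_neg, abs_two]
      gcongr
      exact hre.trans (hf j t)
    nlinarith [mul_le_mul_of_nonneg_right h4 h2.le]
  simp_rw [hsplit]
  rw [lintegral_const_mul _ (by fun_prop)]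
  refine (mul_le_mul_right (lintegral_exp_mul_le_of_centered hξm hξ0 hξ2 hξq hβ.v_pos.le
    hβ.c_pos.le hac) _).trans ?_
  rw [← ENNReal.ofReal_mul (Real.exp_nonneg _), ← Real.exp_add]
  exact ENNReal.ofReal_le_ofReal (hβ.exp_le hs (norm_nonneg _) (hf j t) hre (he j t))

theorem sum_law_mul_one_add_eq {law : Measure (Matrix (Fin d) (Fin T) ℝ)}
    [IsProbabilityMeasure law] (hlaw : ∀ᵐ X ∂law, X ∈ entryMatrices d T)
    (f : Matrix (Fin d) (Fin T) ℂ) (e : Matrix (Fin d) (Fin T) ℝ) (s β : ℝ) :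
    ∑ j, ∑ t, law.real {Matrix.single j t 1} *
      (1 + (s * (‖f j t‖ ^ 2 - 2 * (f j t).re * e j t) + β * ‖f j t‖ ^ 2 / 8)) =
      1 + (s * (normSqPi law f - 2 * crossTerm law f e) + β * normSqPi law f / 8) := by
  have h1 := sum_law_single hlaw
  have h2 := normSqPi_eq_sum hlaw f
  calc ∑ j, ∑ t, law.real {Matrix.single j t 1} *
      (1 + (s * (‖f j t‖ ^ 2 - 2 * (f j t).re * e j t) + β * ‖f j t‖ ^ 2 / 8))
      = ∑ j, ∑ t, (law.real {(Matrix.single j t 1 : Matrix (Fin d) (Fin T) ℝ)} +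
          (s + β / 8) * (law.real {Matrix.single j t 1} * ‖f j t‖ ^ 2) -
          2 * s * (law.real {Matrix.single j t 1} * (f j t).re * e j t)) :=
        Finset.sum_congr rfl fun j _ => Finset.sum_congr rfl fun t _ => by ring
    _ = 1 + (s + β / 8) * normSqPi law f - 2 * s * crossTerm law f e := by
        simp only [Finset.sum_sub_distrib, Finset.sum_add_distrib, ← Finset.mul_sum]
        rw [h1, h2, crossTerm]
    _ = _ := by ring

theorem ae_map_mem_entryMatrices {Ω : Type*} [MeasurableSpace Ω] {P : Measure Ω}
    {X : Ω → Matrix (Fin d) (Fin T) ℝ} (hX : Measurable X)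
    (hmem : ∀ᵐ ω ∂P, X ω ∈ entryMatrices d T) : ∀ᵐ x ∂(P.map X), x ∈ entryMatrices d T := by
  have hfin : (entryMatrices d T).Finite := by
    refine (Set.finite_range
      fun p : Fin d × Fin T => (Matrix.single p.1 p.2 1 : Matrix _ _ ℝ)).subset ?_
    rintro x ⟨j, t, rfl⟩
    exact ⟨(j, t), rfl⟩
  exact (ae_map_iff hX.aemeasurable hfin.measurableSet).2 hmem

theorem lintegral_exp_excessLoss_le {Ω : Type*} [MeasurableSpace Ω] {P : Measure Ω}
    [IsProbabilityMeasure P] {X : Ω → Matrix (Fin d) (Fin T) ℝ} {ξ : Ω → ℝ} (hX : Measurable X)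
    (hξm : Measurable ξ) (hind : IndepFun X ξ P) (hmem : ∀ᵐ ω ∂P, X ω ∈ entryMatrices d T)
    {m0 mε v c β : ℝ} (hβ : IsSmallStep β m0 mε v c) (hξ0 : ∫ ω, ξ ω ∂P = 0)
    (hξ2 : Integrable (fun ω => ξ ω ^ 2) P ∧ ∫ ω, ξ ω ^ 2 ∂P ≤ v)
    (hξq : ∀ q : ℕ, 3 ≤ q → Integrable (fun ω => |ξ ω| ^ q) P ∧
      ∫ ω, |ξ ω| ^ q ∂P ≤ v * c ^ (q - 2) * (Nat.factorial q : ℝ) / 2)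
    {f : Matrix (Fin d) (Fin T) ℂ} (hf : ∀ j t, ‖f j t‖ ≤ 2 * m0)
    {e : Matrix (Fin d) (Fin T) ℝ} (he : ∀ j t, |e j t| ≤ mε) {s : ℝ} (hs : |s| = β) :
    ∫⁻ ω, ENNReal.ofReal (Real.exp (s * excessLoss f e (X ω) (ξ ω))) ∂P ≤
      ENNReal.ofReal (Real.exp (s * (normSqPi (P.map X) f - 2 * crossTerm (P.map X) f e) +
        β * normSqPi (P.map X) f / 8)) := by
  have hlawP : IsProbabilityMeasure (P.map X) := Measure.isProbabilityMeasure_map hX.aemeasurable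
  have hlmem := ae_map_mem_entryMatrices hX hmem
  have hterm := lintegral_exp_excessLoss_single_le hξm hβ hξ0 hξ2 hξq hf he hs
  have hnn : ∀ j t,
      0 ≤ 1 + (s * (‖f j t‖ ^ 2 - 2 * (f j t).re * e j t) + β * ‖f j t‖ ^ 2 / 8) := fun j t =>
    (Real.exp_nonneg _).trans
      (hβ.exp_le hs (norm_nonneg _) (hf j t) (Complex.abs_re_le_norm _) (he j t))
  calc ∫⁻ ω, ENNReal.ofReal (Real.exp (s * excessLoss f e (X ω) (ξ ω))) ∂P
      ≤ ∑ j, ∑ t, P.map X {Matrix.single j t 1} * ∫⁻ ω, ENNReal.ofReal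
          (Real.exp (s * excessLoss f e (Matrix.single j t 1) (ξ ω))) ∂P := by
        have hm : ∀ x, Measurable fun z =>
            ENNReal.ofReal (Real.exp (s * excessLoss f e x z)) := by
          intro x
          have h := (measurable_excessLoss_right f e x).const_mul s
          exact h.exp.ennreal_ofReal
        have h := lintegral_entryMatrices_le hX hξm hind hmem
          (fun x z => ENNReal.ofReal (Real.exp (s * excessLoss f e x z))) hm
        exact h
    _ ≤ ∑ j, ∑ t, ENNReal.ofReal ((P.map X).real {Matrix.single j t 1} *
          (1 + (s * (‖f j t‖ ^ 2 - 2 * (f j t).re * e j t) + β * ‖f j t‖ ^ 2 / 8))) := by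
        refine Finset.sum_le_sum fun j _ => Finset.sum_le_sum fun t _ => ?_
        rw [ENNReal.ofReal_mul measureReal_nonneg, ofReal_measureReal]
        exact mul_le_mul_right (hterm j t) _
    _ = ENNReal.ofReal (∑ j, ∑ t, (P.map X).real {Matrix.single j t 1} *
          (1 + (s * (‖f j t‖ ^ 2 - 2 * (f j t).re * e j t) + β * ‖f j t‖ ^ 2 / 8))) := by
        rw [ENNReal.ofReal_sum_of_nonneg fun j _ => Finset.sum_nonneg fun t _ =>
          mul_nonneg measureReal_nonneg (hnn j t)]
        refine Finset.sum_congr rfl fun j _ => ?_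
        rw [ENNReal.ofReal_sum_of_nonneg fun t _ => mul_nonneg measureReal_nonneg (hnn j t)]
    _ ≤ _ := by
        refine ENNReal.ofReal_le_ofReal ?_
        rw [sum_law_mul_one_add_eq hlmem]
        linarith [Real.add_one_le_exp
          (s * (normSqPi (P.map X) f - 2 * crossTerm (P.map X) f e) + β * normSqPi (P.map X) f / 8)]

end ExcessLoss

/-! ### Deviations of the empirical excess risk -/

section Deviation

variable {d T n : ℕ}

theorem measurable_crossTerm (law : Measure (Matrix (Fin d) (Fin T) ℝ))
    (f : Matrix (Fin d) (Fin T) ℂ) : Measurable (crossTerm law f) := by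
  unfold crossTerm
  exact Finset.measurable_sum _ fun j _ => Finset.measurable_sum _ fun t _ =>
    (measurable_matrix_entry j t).const_mul _

/-- Conditionally on the time series noise the observations are independent. -/
theorem lintegral_exp_sum_excessLoss_le {Ω : Type*} [MeasurableSpace Ω] {P : Measure Ω}
    [IsProbabilityMeasure P] {X : Fin n → Ω → Matrix (Fin d) (Fin T) ℝ} {ξ : Fin n → Ω → ℝ}
    {law : Measure (Matrix (Fin d) (Fin T) ℝ)} (hX : ∀ i, Measurable (X i))
    (hξm : ∀ i, Measurable (ξ i)) (hXlaw : ∀ i, P.map (X i) = law)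
    (hpairs : iIndepFun (fun i ω => (X i ω, ξ i ω)) P) (hind : ∀ i, IndepFun (X i) (ξ i) P)
    (hmem : ∀ i, ∀ᵐ ω ∂P, X i ω ∈ entryMatrices d T)
    {m0 mε v c β : ℝ} (hβ : IsSmallStep β m0 mε v c) (hξ0 : ∀ i, ∫ ω, ξ i ω ∂P = 0)
    (hξ2 : ∀ i, Integrable (fun ω => ξ i ω ^ 2) P ∧ ∫ ω, ξ i ω ^ 2 ∂P ≤ v)
    (hξq : ∀ q : ℕ, 3 ≤ q → ∀ i, Integrable (fun ω => |ξ i ω| ^ q) P ∧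
      ∫ ω, |ξ i ω| ^ q ∂P ≤ v * c ^ (q - 2) * (Nat.factorial q : ℝ) / 2)
    {f : Matrix (Fin d) (Fin T) ℂ} (hf : ∀ j t, ‖f j t‖ ≤ 2 * m0)
    {e : Matrix (Fin d) (Fin T) ℝ} (he : ∀ j t, |e j t| ≤ mε) {s : ℝ} (hs : |s| = β) :
    ∫⁻ ω, ENNReal.ofReal (Real.exp (s * ∑ i, excessLoss f e (X i ω) (ξ i ω))) ∂P ≤
      ENNReal.ofReal (Real.exp (n * (s * (normSqPi law f - 2 * crossTerm law f e) +
        β * normSqPi law f / 8))) := by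
  have hm : ∀ i : Fin n, Measurable fun p : Matrix (Fin d) (Fin T) ℝ × ℝ =>
      ENNReal.ofReal (Real.exp (s * excessLoss f e p.1 p.2)) := fun _ =>
    (Real.measurable_exp.comp ((measurable_excessLoss_left f e).const_mul s)).ennreal_ofReal
  have hprod : ∀ ω, ENNReal.ofReal (Real.exp (s * ∑ i, excessLoss f e (X i ω) (ξ i ω))) =
      ∏ i, ENNReal.ofReal (Real.exp (s * excessLoss f e (X i ω) (ξ i ω))) := by
    intro ω
    rw [Finset.mul_sum, Real.exp_sum, ENNReal.ofReal_prod_of_nonneg fun i _ => Real.exp_nonneg _]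
  simp_rw [hprod]
  have hi : iIndepFun
      (fun i ω => ENNReal.ofReal (Real.exp (s * excessLoss f e (X i ω) (ξ i ω)))) P :=
    hpairs.comp _ hm
  have hmi : ∀ i, Measurable fun ω =>
      ENNReal.ofReal (Real.exp (s * excessLoss f e (X i ω) (ξ i ω))) := by
    intro i
    have h := (hm i).comp ((hX i).prodMk (hξm i))
    exact h
  rw [lintegral_prod_eq_prod_lintegral_of_indepFun Finset.univ _ hi hmi]
  calc ∏ i, ∫⁻ ω, ENNReal.ofReal (Real.exp (s * excessLoss f e (X i ω) (ξ i ω))) ∂P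
      ≤ ∏ _i : Fin n, ENNReal.ofReal (Real.exp (s * (normSqPi law f - 2 * crossTerm law f e) +
        β * normSqPi law f / 8)) := by
        refine Finset.prod_le_prod' fun i _ => ?_
        rw [← hXlaw i]
        exact lintegral_exp_excessLoss_le (hX i) (hξm i) (hind i) (hmem i) hβ (hξ0 i) (hξ2 i)
          (fun q hq => hξq q hq i) hf he hs
    _ = _ := by
        rw [Finset.prod_const, Finset.card_univ, Fintype.card_fin,
          ← ENNReal.ofReal_pow (Real.exp_nonneg _), ← Real.exp_nat_mul]

/-- The sampling probabilities are at most `c_Π / (d T)`, which pays for the `⌊T / n⌋ + 1` blocks of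
each row. -/
theorem sum_sq_crossWeights_le {law : Measure (Matrix (Fin d) (Fin T) ℝ)} [IsFiniteMeasure law]
    (hlaw : ∀ᵐ X ∂law, X ∈ entryMatrices d T) {cPi : ℝ} (hcPi : 0 ≤ cPi)
    (hle : ∀ j t, law.real {Matrix.single j t 1} ≤ cPi / ((d : ℝ) * T)) (hd : 1 ≤ d) (hT : 1 ≤ T)
    (hn : 1 ≤ n) (hnT : n ≤ d * T) (f : Matrix (Fin d) (Fin T) ℂ) :
    ((T / n + 1 : ℕ) : ℝ) * ∑ j, ∑ t, (law.real {Matrix.single j t 1} * (f j t).re) ^ 2 ≤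
      2 * cPi / n * normSqPi law f := by
  have hd' : (1 : ℝ) ≤ d := by exact_mod_cast hd
  have hT' : (1 : ℝ) ≤ T := by exact_mod_cast hT
  have hn' : (1 : ℝ) ≤ n := by exact_mod_cast hn
  have hnT' : (n : ℝ) ≤ d * T := by exact_mod_cast hnT
  have h1 : ∑ j, ∑ t, (law.real {Matrix.single j t 1} * (f j t).re) ^ 2 ≤
      cPi / ((d : ℝ) * T) * normSqPi law f := by
    rw [normSqPi_eq_sum hlaw, Finset.mul_sum]
    refine Finset.sum_le_sum fun j _ => ?_
    rw [Finset.mul_sum]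
    refine Finset.sum_le_sum fun t _ => ?_
    have h2 : (f j t).re ^ 2 ≤ ‖f j t‖ ^ 2 := by
      rw [← sq_abs]; gcongr; exact Complex.abs_re_le_norm _
    calc (law.real {Matrix.single j t 1} * (f j t).re) ^ 2
        = law.real {Matrix.single j t 1} * (law.real {Matrix.single j t 1} * (f j t).re ^ 2) := by
          ring
      _ ≤ cPi / ((d : ℝ) * T) * (law.real {Matrix.single j t 1} * ‖f j t‖ ^ 2) := by
          gcongr
          exact hle j t
  have hv : 0 ≤ normSqPi law f := integral_nonneg fun _ => sq_nonneg _
  have hN : ((T / n + 1 : ℕ) : ℝ) / ((d : ℝ) * T) ≤ 2 / n := by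
    rw [div_le_div_iff₀ (by positivity) (by positivity)]
    have h3 : ((T / n : ℕ) : ℝ) * n ≤ T := by exact_mod_cast Nat.div_mul_le_self T n
    push_cast
    nlinarith
  calc ((T / n + 1 : ℕ) : ℝ) * ∑ j, ∑ t, (law.real {Matrix.single j t 1} * (f j t).re) ^ 2
      ≤ ((T / n + 1 : ℕ) : ℝ) * (cPi / ((d : ℝ) * T) * normSqPi law f) := by gcongr
    _ = ((T / n + 1 : ℕ) : ℝ) / ((d : ℝ) * T) * (cPi * normSqPi law f) := by ring
    _ ≤ 2 / n * (cPi * normSqPi law f) := by gcongr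
    _ = _ := by ring

theorem hasSubgaussianMGF_crossTerm {Ω Ω' : Type*} [MeasurableSpace Ω] [MeasurableSpace Ω']
    {P : Measure Ω} [IsProbabilityMeasure P] {P' : Measure Ω'} [IsProbabilityMeasure P']
    {law : Measure (Matrix (Fin d) (Fin T) ℝ)} [IsFiniteMeasure law]
    (hlaw : ∀ᵐ X ∂law, X ∈ entryMatrices d T) {cPi : ℝ} (hcPi : 0 ≤ cPi)
    (hle : ∀ j t, law.real {Matrix.single j t 1} ≤ cPi / ((d : ℝ) * T)) (hd : 1 ≤ d) (hT : 1 ≤ T)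
    (hn : 1 ≤ n) (hnT : n ≤ d * T) (f : Matrix (Fin d) (Fin T) ℂ)
    {ε : Ω → Matrix (Fin d) (Fin T) ℝ}
    (hεind : iIndepFun (fun j ω => ε ω j) P) (hε0 : ∀ j t, ∫ ω, ε ω j t ∂P = 0)
    {Z : ℤ → Ω' → ℝ} (hZm : ∀ t, Measurable (Z t))
    (hεZ : ∀ j, IdentDistrib (fun ω => ε ω j)
      (fun ω' (t : Fin T) => Z (((t : ℕ) : ℤ) + 1) ω') P P')
    {mε : ℝ} (hmε : 0 ≤ mε) (hεb : ∀ᵐ ω ∂P, ∀ j t, |ε ω j t| ≤ mε) :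
    HasSubgaussianMGF (fun ω => crossTerm law f (ε ω))
      (Real.toNNReal (32 * mε ^ 2 * mixingSum P' Z n ^ 2 * cPi / n * normSqPi law f)) P := by
  set b : Fin d → Fin T → ℝ := fun j t => law.real {Matrix.single j t 1} * (f j t).re with hb
  set N := T / n + 1 with hN
  have hTN : T ≤ N * n := by
    have := Nat.lt_div_mul_add (a := T) (b := n) (by omega)
    rw [hN, Nat.succ_mul]; omega
  let j₀ : Fin d := ⟨0, hd⟩
  have hident : ∀ t : Fin T, IdentDistrib (fun ω => ε ω j₀ t) (Z (((t : ℕ) : ℤ) + 1)) P P' :=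
    fun t => (hεZ j₀).comp (measurable_pi_apply t)
  have hZb : ∀ t : Fin T, ∀ᵐ ω ∂P', |Z (((t : ℕ) : ℤ) + 1) ω| ≤ mε := by
    intro t
    refine (hident t).ae_mem_snd (t := {x | |x| ≤ mε}) (measurableSet_le (by fun_prop) (by fun_prop))
      ?_
    filter_upwards [hεb] with ω h using h j₀ t
  have hZ0 : ∀ t : Fin T, ∫ ω, Z (((t : ℕ) : ℤ) + 1) ω ∂P' = 0 := fun t => by
    rw [← (hident t).integral_eq, hε0]
  have hrow : ∀ j, HasSubgaussianMGF (fun ω => ∑ t, b j t * ε ω j t)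
      (Real.toNNReal (16 * mε ^ 2 * mixingSum P' Z n ^ 2 * N * ∑ t, b j t ^ 2)) P := by
    intro j
    have h1 : IdentDistrib (fun ω => ∑ t, b j t * ε ω j t)
        (fun ω' => ∑ t, b j t * Z (((t : ℕ) : ℤ) + 1) ω') P P' :=
      (hεZ j).comp (u := fun y : Fin T → ℝ => ∑ t, b j t * y t) (by fun_prop)
    exact (hasSubgaussianMGF_row hZm hmε hTN hZb hZ0 (b j)
      (Real.le_coe_toNNReal _)).congr_identDistrib h1.symm
  have hind : iIndepFun (fun j ω => ∑ t, b j t * ε ω j t) P :=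
    hεind.comp (fun j (y : Fin T → ℝ) => ∑ t, b j t * y t) fun j => by fun_prop
  have hsum := HasSubgaussianMGF.sum_of_iIndepFun hind (s := Finset.univ) fun j _ => hrow j
  refine hasSubgaussianMGF_mono hsum ?_
  rw [← NNReal.coe_le_coe]
  refine le_trans ?_ (Real.le_coe_toNNReal _)
  rw [NNReal.coe_sum]
  calc ∑ j, ((16 * mε ^ 2 * mixingSum P' Z n ^ 2 * N * ∑ t, b j t ^ 2).toNNReal : ℝ)
      = 16 * mε ^ 2 * mixingSum P' Z n ^ 2 * (N * ∑ j, ∑ t, b j t ^ 2) := by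
        rw [← mul_assoc, Finset.mul_sum]
        refine Finset.sum_congr rfl fun j _ => Real.coe_toNNReal _ ?_
        exact mul_nonneg (by positivity) (Finset.sum_nonneg fun t _ => sq_nonneg _)
    _ ≤ 16 * mε ^ 2 * mixingSum P' Z n ^ 2 * (2 * cPi / n * normSqPi law f) := by
        exact mul_le_mul_of_nonneg_left
          (sum_sq_crossWeights_le hlaw hcPi hle hd hT hn hnT f) (by positivity)
    _ = _ := by ring

end Deviation

section Tail

variable {d T n : ℕ}

/-- Chernoff's bound. -/
theorem measure_add_le_of_lintegral_exp_le {Ω : Type*} [MeasurableSpace Ω] {P : Measure Ω}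
    {U : Ω → ℝ} (hU : Measurable U) {a : ℝ}
    (h : ∫⁻ ω, ENNReal.ofReal (Real.exp (U ω)) ∂P ≤ ENNReal.ofReal (Real.exp a)) (x : ℝ) :
    P {ω | a + x ≤ U ω} ≤ ENNReal.ofReal (Real.exp (-x)) := by
  have hpos : 0 < ENNReal.ofReal (Real.exp (a + x)) := ENNReal.ofReal_pos.2 (Real.exp_pos _)
  have hset : {ω | a + x ≤ U ω} =
      {ω | ENNReal.ofReal (Real.exp (a + x)) ≤ ENNReal.ofReal (Real.exp (U ω))} := by
    ext ω
    simp only [Set.mem_ofPred_eq]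
    rw [ENNReal.ofReal_le_ofReal_iff (Real.exp_nonneg _), Real.exp_le_exp]
  rw [hset]
  refine (meas_ge_le_lintegral_div hU.exp.ennreal_ofReal.aemeasurable hpos.ne'
    ENNReal.ofReal_ne_top).trans ?_
  refine (ENNReal.div_le_div_right h _).trans (le_of_eq ?_)
  rw [← ENNReal.ofReal_div_of_pos (Real.exp_pos _), ← Real.exp_sub]
  congr 2
  ring

theorem measure_sum_abs_ge_le {Ω : Type*} [MeasurableSpace Ω] {P : Measure Ω}
    [IsProbabilityMeasure P] {ξ : Fin n → Ω → ℝ} (hξm : ∀ i, Measurable (ξ i))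
    (hind : iIndepFun ξ P) {v c : ℝ} (hv : 0 ≤ v) (hc : 0 ≤ c)
    (hξ2 : ∀ i, Integrable (fun ω => ξ i ω ^ 2) P ∧ ∫ ω, ξ i ω ^ 2 ∂P ≤ v)
    (hξq : ∀ q : ℕ, 3 ≤ q → ∀ i, Integrable (fun ω => |ξ i ω| ^ q) P ∧
      ∫ ω, |ξ i ω| ^ q ∂P ≤ v * c ^ (q - 2) * (Nat.factorial q : ℝ) / 2)
    {u : ℝ} (hu : 0 ≤ u) (huc : u * c ≤ 1 / 2) (huv : u ^ 2 * v ≤ 1) (x : ℝ) :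
    P {ω | n * 2 + x ≤ u * ∑ i, |ξ i ω|} ≤ ENNReal.ofReal (Real.exp (-x)) := by
  refine measure_add_le_of_lintegral_exp_le (by fun_prop) ?_ x
  have hprod : ∀ ω, ENNReal.ofReal (Real.exp (u * ∑ i, |ξ i ω|)) =
      ∏ i, ENNReal.ofReal (Real.exp (u * |ξ i ω|)) := by
    intro ω
    rw [Finset.mul_sum, Real.exp_sum, ENNReal.ofReal_prod_of_nonneg fun i _ => Real.exp_nonneg _]
  simp_rw [hprod]
  have hi : iIndepFun (fun i ω => ENNReal.ofReal (Real.exp (u * |ξ i ω|))) P :=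
    hind.comp (fun _ z => ENNReal.ofReal (Real.exp (u * |z|))) fun _ => by fun_prop
  rw [lintegral_prod_eq_prod_lintegral_of_indepFun Finset.univ _ hi fun i => by fun_prop]
  calc ∏ i, ∫⁻ ω, ENNReal.ofReal (Real.exp (u * |ξ i ω|)) ∂P
      ≤ ∏ _i : Fin n, ENNReal.ofReal (Real.exp 2) :=
        Finset.prod_le_prod' fun i _ => lintegral_exp_mul_abs_le (hξm i) (hξ2 i)
          (fun q hq => hξq q hq i) hv hc hu huc huv
    _ = _ := by
        rw [Finset.prod_const, Finset.card_univ, Fintype.card_fin,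
          ← ENNReal.ofReal_pow (Real.exp_nonneg _), ← Real.exp_nat_mul]

theorem measurable_sum_excessLoss (f : Matrix (Fin d) (Fin T) ℂ) :
    Measurable fun p : (Fin n → Matrix (Fin d) (Fin T) ℝ × ℝ) × Matrix (Fin d) (Fin T) ℝ =>
      ∑ i, excessLoss f p.2 (p.1 i).1 (p.1 i).2 := by
  refine Finset.measurable_sum _ fun i _ => ?_
  have h1 : Measurable fun p :
      (Fin n → Matrix (Fin d) (Fin T) ℝ × ℝ) × Matrix (Fin d) (Fin T) ℝ => (p.1 i, p.2) :=
    ((measurable_pi_apply i).comp measurable_fst).prodMk measurable_snd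
  have h2 := (measurable_excessLoss f).comp h1
  exact h2

/-- Exponential moments of the empirical excess risk: the noise of the time series is integrated out
last, through the sub-Gaussian bound on `crossTerm`. -/
theorem lintegral_exp_sum_excessLoss_noise_le {Ω Ω' : Type*} [MeasurableSpace Ω]
    [MeasurableSpace Ω'] {P : Measure Ω} [IsProbabilityMeasure P] {P' : Measure Ω'}
    [IsProbabilityMeasure P'] {X : Fin n → Ω → Matrix (Fin d) (Fin T) ℝ} {ξ : Fin n → Ω → ℝ}
    {ε : Ω → Matrix (Fin d) (Fin T) ℝ} {law : Measure (Matrix (Fin d) (Fin T) ℝ)}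
    (hd : 1 ≤ d) (hT : 1 ≤ T) (hn : 1 ≤ n) (hnT : n ≤ d * T)
    (hX : ∀ i, Measurable (X i)) (hξm : ∀ i, Measurable (ξ i)) (hεm : Measurable ε)
    (hXlaw : ∀ i, P.map (X i) = law)
    (hpairs : iIndepFun (fun i ω => (X i ω, ξ i ω)) P) (hind : ∀ i, IndepFun (X i) (ξ i) P)
    (hXξε : IndepFun (fun ω i => (X i ω, ξ i ω)) ε P)
    (hmem : ∀ i, ∀ᵐ ω ∂P, X i ω ∈ entryMatrices d T)
    {m0 mε v c β : ℝ} (hβ : IsSmallStep β m0 mε v c) (hξ0 : ∀ i, ∫ ω, ξ i ω ∂P = 0)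
    (hξ2 : ∀ i, Integrable (fun ω => ξ i ω ^ 2) P ∧ ∫ ω, ξ i ω ^ 2 ∂P ≤ v)
    (hξq : ∀ q : ℕ, 3 ≤ q → ∀ i, Integrable (fun ω => |ξ i ω| ^ q) P ∧
      ∫ ω, |ξ i ω| ^ q ∂P ≤ v * c ^ (q - 2) * (Nat.factorial q : ℝ) / 2)
    {cPi : ℝ} (hcPi : 0 ≤ cPi)
    (hle : ∀ j t, law.real {Matrix.single j t 1} ≤ cPi / ((d : ℝ) * T))
    (hεind : iIndepFun (fun j ω => ε ω j) P) (hε0 : ∀ j t, ∫ ω, ε ω j t ∂P = 0)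
    {Z : ℤ → Ω' → ℝ} (hZm : ∀ t, Measurable (Z t))
    (hεZ : ∀ j, IdentDistrib (fun ω => ε ω j)
      (fun ω' (t : Fin T) => Z (((t : ℕ) : ℤ) + 1) ω') P P')
    (hεb : ∀ᵐ ω ∂P, ∀ j t, |ε ω j t| ≤ mε)
    (hβΦ : 256 * β * (mε ^ 2 * mixingSum P' Z n ^ 2 * cPi) ≤ 1)
    {f : Matrix (Fin d) (Fin T) ℂ} (hf : ∀ j t, ‖f j t‖ ≤ 2 * m0) {s : ℝ} (hs : |s| = β) :
    ∫⁻ ω, ENNReal.ofReal (Real.exp (s * ∑ i, excessLoss f (ε ω) (X i ω) (ξ i ω))) ∂P ≤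
      ENNReal.ofReal (Real.exp (n * (s * normSqPi law f + β * normSqPi law f / 2))) := by
  have hlaw : ∀ᵐ x ∂law, x ∈ entryMatrices d T := by
    rw [← hXlaw ⟨0, hn⟩]
    exact ae_map_mem_entryMatrices (hX _) (hmem _)
  have hlawP : IsProbabilityMeasure law := by
    rw [← hXlaw ⟨0, hn⟩]
    exact Measure.isProbabilityMeasure_map (hX _).aemeasurable
  set V := normSqPi law f with hV
  have hV0 : 0 ≤ V := integral_nonneg fun _ => sq_nonneg _
  set D : Ω → Fin n → Matrix (Fin d) (Fin T) ℝ × ℝ := fun ω i => (X i ω, ξ i ω) with hD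
  have hDm : Measurable D := measurable_pi_lambda _ fun i => (hX i).prodMk (hξm i)
  set g : (Fin n → Matrix (Fin d) (Fin T) ℝ × ℝ) × Matrix (Fin d) (Fin T) ℝ → ENNReal :=
    fun p => ENNReal.ofReal (Real.exp (s * ∑ i, excessLoss f p.2 (p.1 i).1 (p.1 i).2)) with hg
  have hgm : Measurable g := ((measurable_sum_excessLoss f).const_mul s).exp.ennreal_ofReal
  have hbm : MeasurableSet {e : Matrix (Fin d) (Fin T) ℝ | ∀ j t, |e j t| ≤ mε} := by
    simp only [Set.ofPred_forall]
    refine MeasurableSet.iInter fun j => MeasurableSet.iInter fun t => ?_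
    exact measurableSet_le (measurable_matrix_entry j t).abs measurable_const
  have hbe : ∀ᵐ e ∂(P.map ε), ∀ j t, |e j t| ≤ mε := (ae_map_iff hεm.aemeasurable hbm).2 hεb
  have hDP : IsProbabilityMeasure (P.map D) := Measure.isProbabilityMeasure_map hDm.aemeasurable
  have hεP : IsProbabilityMeasure (P.map ε) := Measure.isProbabilityMeasure_map hεm.aemeasurable
  have hDε : P.map (fun ω => (D ω, ε ω)) = (P.map D).prod (P.map ε) :=
    (indepFun_iff_map_prod_eq_prod_map_map hDm.aemeasurable hεm.aemeasurable).1 hXξε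
  set b : Matrix (Fin d) (Fin T) ℝ → ENNReal := fun e => ENNReal.ofReal
    (Real.exp (n * (s * (V - 2 * crossTerm law f e) + β * V / 8))) with hb
  have hbmeas : Measurable b := by
    have := measurable_crossTerm law f
    have h : Measurable fun e => (n : ℝ) * (s * (V - 2 * crossTerm law f e) + β * V / 8) :=
      (((measurable_const.sub (this.const_mul 2)).const_mul s).add_const _).const_mul _
    exact h.exp.ennreal_ofReal
  have hsub := hasSubgaussianMGF_crossTerm hlaw hcPi hle hd hT hn hnT f hεind hε0 hZm hεZ
    hβ.mε_pos.le hεb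
  have hs2 : s ^ 2 = β ^ 2 := by rw [← hs, sq_abs]
  have hn' : (0 : ℝ) < n := by exact_mod_cast hn
  calc ∫⁻ ω, ENNReal.ofReal (Real.exp (s * ∑ i, excessLoss f (ε ω) (X i ω) (ξ i ω))) ∂P
      = ∫⁻ ω, g (D ω, ε ω) ∂P := rfl
    _ = ∫⁻ p, g p ∂((P.map D).prod (P.map ε)) := by
        rw [← hDε, lintegral_map hgm (hDm.prodMk hεm)]
    _ = ∫⁻ e, ∫⁻ p, g (p, e) ∂(P.map D) ∂(P.map ε) := lintegral_prod_symm _ hgm.aemeasurable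
    _ ≤ ∫⁻ e, b e ∂(P.map ε) := by
        refine lintegral_mono_ae ?_
        filter_upwards [hbe] with e he
        have hge : Measurable fun p => g (p, e) := hgm.comp measurable_prodMk_right
        rw [lintegral_map hge hDm]
        exact lintegral_exp_sum_excessLoss_le hX hξm hXlaw hpairs hind hmem hβ hξ0 hξ2 hξq hf he hs
    _ = ∫⁻ ω, b (ε ω) ∂P := lintegral_map hbmeas hεm
    _ = ENNReal.ofReal (Real.exp (n * (s * V + β * V / 8))) *
          ∫⁻ ω, ENNReal.ofReal (Real.exp ((-2 * n * s) * crossTerm law f (ε ω))) ∂P := by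
        rw [← lintegral_const_mul]
        · refine lintegral_congr fun ω => ?_
          rw [← ENNReal.ofReal_mul (Real.exp_nonneg _), ← Real.exp_add]
          simp only [hb]
          ring_nf
        · have h := ((measurable_crossTerm law f).comp hεm).const_mul (-2 * (n : ℝ) * s)
          exact h.exp.ennreal_ofReal
    _ = ENNReal.ofReal (Real.exp (n * (s * V + β * V / 8))) *
          ENNReal.ofReal (mgf (fun ω => crossTerm law f (ε ω)) P (-2 * n * s)) := by
        rw [mgf, ofReal_integral_eq_lintegral_ofReal (hsub.integrable_exp_mul _)
          (Filter.Eventually.of_forall fun ω => Real.exp_nonneg _)]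
    _ ≤ ENNReal.ofReal (Real.exp (n * (s * V + β * V / 8))) *
          ENNReal.ofReal (Real.exp (n * (β * V / 4))) := by
        refine mul_le_mul_right (ENNReal.ofReal_le_ofReal ((hsub.mgf_le _).trans
          (Real.exp_le_exp.2 ?_))) _
        have hβ0 := hβ.pos
        rw [Real.coe_toNNReal _ (by positivity)]
        calc 32 * mε ^ 2 * mixingSum P' Z n ^ 2 * cPi / n * V * (-2 * n * s) ^ 2 / 2
            = 64 * n * s ^ 2 * V * (mε ^ 2 * mixingSum P' Z n ^ 2 * cPi) := by
              field_simp
              ring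
          _ = n * β * V / 4 * (256 * β * (mε ^ 2 * mixingSum P' Z n ^ 2 * cPi)) := by
              rw [hs2]; ring
          _ ≤ n * β * V / 4 * 1 := by gcongr
          _ = _ := by ring
    _ ≤ _ := by
        rw [← ENNReal.ofReal_mul (Real.exp_nonneg _), ← Real.exp_add]
        refine ENNReal.ofReal_le_ofReal (Real.exp_le_exp.2 ?_)
        have hβ0 := hβ.pos
        have : 0 ≤ n * (β * V) := by positivity
        linarith

end Tail

/-! ### Discretization of the models -/

section Net

/-- The midpoint of the `i`-th of `n` intervals of equal length that cover `[-ρ, ρ]`. -/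
noncomputable def gridPoint (ρ : ℝ) {n : ℕ} (i : Fin n) : ℝ := -ρ + (2 * (i : ℕ) + 1) * ρ / n

theorem abs_gridPoint_le {ρ : ℝ} (hρ : 0 ≤ ρ) {n : ℕ} (i : Fin n) : |gridPoint ρ i| ≤ ρ := by
  have hn : (0 : ℝ) < n := by exact_mod_cast (Nat.zero_le _).trans_lt i.2
  have hi : ((i : ℕ) : ℝ) + 1 ≤ n := by exact_mod_cast i.2
  have h1 : (2 * ((i : ℕ) : ℝ) + 1) * ρ / n ≤ 2 * ρ := by
    rw [div_le_iff₀ hn]; nlinarith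
  have h2 : 0 ≤ (2 * ((i : ℕ) : ℝ) + 1) * ρ / n := by positivity
  rw [gridPoint, abs_le]
  constructor <;> linarith

theorem exists_gridPoint {ρ : ℝ} (hρ : 0 < ρ) {n : ℕ} (hn : 1 ≤ n) {u : ℝ} (hu : |u| ≤ ρ) :
    ∃ i : Fin n, |u - gridPoint ρ i| ≤ ρ / n := by
  have hn' : (0 : ℝ) < n := by exact_mod_cast hn
  obtain ⟨h1, h2⟩ := abs_le.1 hu
  -- `y` is the position of `u` in units of the interval length
  set y := (u + ρ) * n / (2 * ρ) with hy
  have hu' : u = -ρ + 2 * ρ * y / n := by rw [hy]; field_simp; ring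
  have hy0 : 0 ≤ y := div_nonneg (mul_nonneg (by linarith) hn'.le) (by linarith)
  have hyn : y ≤ n := by
    rw [hy, div_le_iff₀ (by linarith)]; nlinarith
  have key : ∀ i : Fin n, |y - i - 1 / 2| ≤ 1 / 2 → |u - gridPoint ρ i| ≤ ρ / n := by
    intro i hi
    have : u - gridPoint ρ i = 2 * ρ / n * (y - i - 1 / 2) := by
      rw [gridPoint]; nth_rewrite 1 [hu']; field_simp; ring
    rw [this, abs_mul, abs_of_nonneg (by positivity)]
    calc 2 * ρ / n * |y - i - 1 / 2| ≤ 2 * ρ / n * (1 / 2) := by gcongr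
      _ = ρ / n := by ring
  rcases lt_or_eq_of_le hyn with h | h
  · refine ⟨⟨⌊y⌋₊, (Nat.floor_lt hy0).2 h⟩, key _ ?_⟩
    have h3 := Nat.floor_le hy0
    have h4 := Nat.lt_floor_add_one y
    rw [abs_le]
    constructor <;> simp only <;> linarith
  · refine ⟨⟨n - 1, by omega⟩, key _ ?_⟩
    simp only
    rw [h, Nat.cast_sub hn, Nat.cast_one]
    rw [abs_le]
    constructor <;> linarith

/-- The product of two matrices with entries on the grid. -/
noncomputable def netPoint (ρ : ℝ) {d k τ n : ℕ}
    (p : (Fin d → Fin k → Fin n) × (Fin k → Fin τ → Fin n)) : Matrix (Fin d) (Fin τ) ℝ :=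
  Matrix.of (fun j l => gridPoint ρ (p.1 j l)) * Matrix.of (fun l t => gridPoint ρ (p.2 l t))

variable {d k τ n : ℕ} {m0 mΛτ : ℝ}

theorem netPoint_mem_factorSet
    (p : (Fin d → Fin k → Fin n) × (Fin k → Fin τ → Fin n)) :
    netPoint (Real.sqrt (m0 / (k * mΛτ))) p ∈ factorSet d k τ m0 mΛτ :=
  ⟨_, _, fun _ _ => abs_gridPoint_le (Real.sqrt_nonneg _) _,
    fun _ _ => abs_gridPoint_le (Real.sqrt_nonneg _) _, rfl⟩

theorem abs_le_of_mem_factorSet (hk : 1 ≤ k) (hm0 : 0 < m0) (hmΛτ : 1 ≤ mΛτ)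
    {A : Matrix (Fin d) (Fin τ) ℝ} (hA : A ∈ factorSet d k τ m0 mΛτ) (j : Fin d) (t : Fin τ) :
    |A j t| ≤ m0 / mΛτ := by
  obtain ⟨U, V, hU, hV, rfl⟩ := hA
  have hk' : (0 : ℝ) < k := by exact_mod_cast hk
  rw [Matrix.mul_apply]
  calc |∑ l, U j l * V l t| ≤ ∑ l, |U j l * V l t| := Finset.abs_sum_le_sum_abs _ _
    _ ≤ ∑ _l : Fin k, Real.sqrt (m0 / (k * mΛτ)) * Real.sqrt (m0 / (k * mΛτ)) := by
        refine Finset.sum_le_sum fun l _ => ?_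
        rw [abs_mul]
        exact mul_le_mul (hU j l) (hV l t) (abs_nonneg _) (Real.sqrt_nonneg _)
    _ = m0 / mΛτ := by
        rw [Real.mul_self_sqrt (by positivity)]
        simp only [Finset.sum_const, Finset.card_univ, Fintype.card_fin, nsmul_eq_mul]
        field_simp

theorem exists_netPoint (hk : 1 ≤ k) (hn : 1 ≤ n) (hm0 : 0 < m0) (hmΛτ : 1 ≤ mΛτ)
    {A : Matrix (Fin d) (Fin τ) ℝ} (hA : A ∈ factorSet d k τ m0 mΛτ) :
    ∃ p : (Fin d → Fin k → Fin n) × (Fin k → Fin τ → Fin n), ∀ j t,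
      |(A - netPoint (Real.sqrt (m0 / (k * mΛτ))) p) j t| ≤ 2 * m0 / (mΛτ * n) := by
  obtain ⟨U, V, hU, hV, rfl⟩ := hA
  have hk' : (0 : ℝ) < k := by exact_mod_cast hk
  have hn' : (0 : ℝ) < n := by exact_mod_cast hn
  set ρ := Real.sqrt (m0 / (k * mΛτ)) with hρ
  have hρpos : 0 < ρ := Real.sqrt_pos.2 (by positivity)
  have hρ2 : ρ * ρ = m0 / (k * mΛτ) := Real.mul_self_sqrt (by positivity)
  choose p hp using fun j l => exists_gridPoint hρpos hn (hU j l)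
  choose q hq using fun l t => exists_gridPoint hρpos hn (hV l t)
  refine ⟨(p, q), fun j t => ?_⟩
  rw [netPoint, Matrix.sub_apply, Matrix.mul_apply, Matrix.mul_apply, ← Finset.sum_sub_distrib]
  simp only [Matrix.of_apply]
  calc |∑ l, (U j l * V l t - gridPoint ρ (p j l) * gridPoint ρ (q l t))|
      ≤ ∑ l, |U j l * V l t - gridPoint ρ (p j l) * gridPoint ρ (q l t)| :=
        Finset.abs_sum_le_sum_abs _ _
    _ ≤ ∑ _l : Fin k, (ρ * (ρ / n) + ρ / n * ρ) := by
        refine Finset.sum_le_sum fun l _ => ?_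
        have h : U j l * V l t - gridPoint ρ (p j l) * gridPoint ρ (q l t) =
            U j l * (V l t - gridPoint ρ (q l t)) +
              (U j l - gridPoint ρ (p j l)) * gridPoint ρ (q l t) := by ring
        rw [h]
        refine (abs_add_le _ _).trans ?_
        rw [abs_mul, abs_mul]
        exact add_le_add
          (mul_le_mul (hU j l) (hq l t) (abs_nonneg _) hρpos.le)
          (mul_le_mul (hp j l) (abs_gridPoint_le hρpos.le _) (abs_nonneg _) (by positivity))
    _ = 2 * m0 / (mΛτ * n) := by
        rw [show ρ * (ρ / n) + ρ / n * ρ = 2 * (ρ * ρ) / n by ring, hρ2]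
        simp only [Finset.sum_const, Finset.card_univ, Fintype.card_fin, nsmul_eq_mul]
        field_simp

theorem card_net : Fintype.card ((Fin d → Fin k → Fin n) × (Fin k → Fin τ → Fin n)) =
    n ^ (k * (d + τ)) := by
  simp only [Fintype.card_prod, Fintype.card_fun, Fintype.card_fin]
  rw [← pow_mul, ← pow_mul, ← pow_add]
  congr 1
  ring

end Net

section Approximation

variable {d τ T n : ℕ}

theorem toComplex_sub {m p : ℕ} (A B : Matrix (Fin m) (Fin p) ℝ) :
    toComplex (A - B) = toComplex A - toComplex B := by
  ext i j; simp [toComplex]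

theorem trend_sub (A B : Matrix (Fin d) (Fin τ) ℝ) (Λ : Matrix (Fin τ) (Fin T) ℂ) :
    trend (A - B) Λ = trend A Λ - trend B Λ := by
  rw [trend, trend, trend, toComplex_sub, Matrix.sub_mul]

/-- The cross term in the square is real because the noise is. -/
theorem empiricalRisk_sub_empiricalRisk {Θ A : Matrix (Fin d) (Fin T) ℂ}
    {X : Fin n → Matrix (Fin d) (Fin T) ℝ} {e : Matrix (Fin d) (Fin T) ℝ} {z : Fin n → ℝ}
    {Y : Fin n → ℂ} (hY : ∀ i, Y i = frobInner (X i) (Θ + toComplex e) + (z i : ℂ)) :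
    empiricalRisk Y X A - empiricalRisk Y X Θ =
      1 / (n : ℝ) * ∑ i, excessLoss (A - Θ) e (X i) (z i) := by
  rw [empiricalRisk, empiricalRisk, ← mul_sub, ← Finset.sum_sub_distrib]
  congr 1
  refine Finset.sum_congr rfl fun i _ => ?_
  rw [excessLoss, hY, frobInner_add, frobInner_toComplex, frobInner_sub]
  generalize frobInner (X i) Θ = a
  generalize frobInner (X i) A = b
  rw [← Complex.normSq_eq_norm_sq, ← Complex.normSq_eq_norm_sq, ← Complex.normSq_eq_norm_sq]
  simp only [Complex.normSq_apply, Complex.sub_re, Complex.sub_im, Complex.add_re, Complex.add_im,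
    Complex.ofReal_re, Complex.ofReal_im]
  ring

theorem abs_norm_sq_sub_norm_sq_le {a b : ℂ} {M δ : ℝ} (ha : ‖a‖ ≤ M) (hb : ‖b‖ ≤ M)
    (hab : ‖a - b‖ ≤ δ) : |‖a‖ ^ 2 - ‖b‖ ^ 2| ≤ δ * (2 * M) := by
  have h1 : |‖a‖ - ‖b‖| ≤ δ := (abs_norm_sub_norm_le a b).trans hab
  have h2 : ‖a‖ ^ 2 - ‖b‖ ^ 2 = (‖a‖ - ‖b‖) * (‖a‖ + ‖b‖) := by ring
  rw [h2, abs_mul, abs_of_nonneg (a := ‖a‖ + ‖b‖) (by positivity)]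
  exact mul_le_mul h1 (by linarith) (by positivity) ((abs_nonneg _).trans h1)

theorem excessLoss_sub_excessLoss_le {f g : Matrix (Fin d) (Fin T) ℂ} {M δ mε : ℝ}
    (hf : ∀ j t, ‖f j t‖ ≤ M) (hg : ∀ j t, ‖g j t‖ ≤ M) (hfg : ∀ j t, ‖f j t - g j t‖ ≤ δ)
    {e x : Matrix (Fin d) (Fin T) ℝ} (he : ∀ j t, |e j t| ≤ mε) (hx : x ∈ entryMatrices d T)
    (z : ℝ) : excessLoss g e x z - excessLoss f e x z ≤ δ * (2 * M) + 2 * δ * (mε + |z|) := by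
  obtain ⟨j, t, rfl⟩ := hx
  simp only [excessLoss, frobInner_single, realInner_single]
  have h1 := abs_le.1 (abs_norm_sq_sub_norm_sq_le (hf j t) (hg j t) (hfg j t))
  have h2 : |((f j t).re - (g j t).re) * (e j t + z)| ≤ δ * (mε + |z|) := by
    rw [abs_mul]
    refine mul_le_mul ?_ ((abs_add_le _ _).trans (by gcongr; exact he j t)) (abs_nonneg _)
      ((norm_nonneg _).trans (hfg j t))
    rw [← Complex.sub_re]
    exact (Complex.abs_re_le_norm _).trans (hfg j t)
  have h3 := abs_le.1 h2
  linarith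

theorem normSqPi_sub_normSqPi_le {law : Measure (Matrix (Fin d) (Fin T) ℝ)}
    [IsProbabilityMeasure law] (hlaw : ∀ᵐ x ∂law, x ∈ entryMatrices d T)
    {f g : Matrix (Fin d) (Fin T) ℂ} {M δ : ℝ}
    (hf : ∀ j t, ‖f j t‖ ≤ M) (hg : ∀ j t, ‖g j t‖ ≤ M) (hfg : ∀ j t, ‖f j t - g j t‖ ≤ δ) :
    normSqPi law f - normSqPi law g ≤ δ * (2 * M) := by
  have h1 : δ * (2 * M) = ∑ j, ∑ t,
      law.real {(Matrix.single j t 1 : Matrix (Fin d) (Fin T) ℝ)} * (δ * (2 * M)) := by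
    simp_rw [← Finset.sum_mul]
    rw [sum_law_single hlaw, one_mul]
  rw [h1, normSqPi_eq_sum hlaw, normSqPi_eq_sum hlaw, ← Finset.sum_sub_distrib]
  refine Finset.sum_le_sum fun j _ => ?_
  rw [← Finset.sum_sub_distrib]
  refine Finset.sum_le_sum fun t _ => ?_
  rw [← mul_sub]
  exact mul_le_mul_of_nonneg_left
    (abs_le.1 (abs_norm_sq_sub_norm_sq_le (hf j t) (hg j t) (hfg j t))).2 measureReal_nonneg

end Approximation

/-! ### The constants -/

section Constants

variable {m0 v c mε mΛ Φ cPi : ℝ}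

/-- One thirty-second of `cExp⁻¹ ∧ λ^*`: the exponential inequalities are used at `λ = n β`, for
which the penalty `pen k` is exactly the entropy of the `k`-th net divided by `λ`. -/
noncomputable def expStep (m0 v c mε Φ cPi : ℝ) : ℝ :=
  min (cExp m0 v mε Φ cPi)⁻¹ (lamStar m0 c mε) / 32

theorem cExp_pos (hm0 : 0 < m0) : 0 < cExp m0 v mε Φ cPi := by
  have h : 4 * m0 ^ 2 ≤ max (max (4 * m0 ^ 2) (4 * v)) (max (4 * mε ^ 2)
      (2 * mε ^ 2 * Φ ^ 2 * cPi)) := (le_max_left _ _).trans (le_max_left _ _)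
  have : 0 < 4 * m0 ^ 2 := by positivity
  rw [cExp]
  linarith

theorem expStep_pos (hm0 : 0 < m0) : 0 < expStep m0 v c mε Φ cPi := by
  have h : 0 < max m0 (max mε c) := hm0.trans_le (le_max_left _ _)
  have h2 : 0 < lamStar m0 c mε := by rw [lamStar]; positivity
  have h3 := inv_pos.2 (cExp_pos (v := v) (mε := mε) (Φ := Φ) (cPi := cPi) hm0)
  have := lt_min h3 h2
  rw [expStep]
  linarith

theorem expStep_mul_cExp_le (hm0 : 0 < m0) :
    32 * expStep m0 v c mε Φ cPi * cExp m0 v mε Φ cPi ≤ 1 := by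
  have h := cExp_pos (v := v) (mε := mε) (Φ := Φ) (cPi := cPi) hm0
  rw [expStep, mul_div_cancel₀ _ (by norm_num : (32 : ℝ) ≠ 0)]
  calc _ ≤ (cExp m0 v mε Φ cPi)⁻¹ * cExp m0 v mε Φ cPi := by gcongr; exact min_le_left _ _
    _ = 1 := inv_mul_cancel₀ h.ne'

theorem expStep_mul_le (hm0 : 0 < m0) :
    512 * expStep m0 v c mε Φ cPi * (m0 * max m0 (max mε c)) ≤ 1 := by
  have h : 0 < max m0 (max mε c) := hm0.trans_le (le_max_left _ _)
  have h1 : 32 * expStep m0 v c mε Φ cPi ≤ lamStar m0 c mε := by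
    rw [expStep, mul_div_cancel₀ _ (by norm_num : (32 : ℝ) ≠ 0)]
    exact min_le_right _ _
  calc 512 * expStep m0 v c mε Φ cPi * (m0 * max m0 (max mε c))
      = 32 * expStep m0 v c mε Φ cPi * (16 * m0 * max m0 (max mε c)) := by ring
    _ ≤ lamStar m0 c mε * (16 * m0 * max m0 (max mε c)) := by gcongr
    _ = 1 := by rw [lamStar]; exact inv_mul_cancel₀ (by positivity)

theorem isSmallStep_expStep (hm0 : 0 < m0) (hv : 0 < v) (hc : 0 < c) (hmε : 0 < mε) :
    IsSmallStep (expStep m0 v c mε Φ cPi) m0 mε v c := by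
  have hβ := expStep_pos (v := v) (c := c) (mε := mε) (Φ := Φ) (cPi := cPi) hm0
  have hE := expStep_mul_cExp_le (v := v) (c := c) (mε := mε) (Φ := Φ) (cPi := cPi) hm0
  have key : ∀ y, 4 * y ≤ max (max (4 * m0 ^ 2) (4 * v)) (max (4 * mε ^ 2)
      (2 * mε ^ 2 * Φ ^ 2 * cPi)) → 512 * expStep m0 v c mε Φ cPi * y ≤ 1 := by
    intro y hy
    have h1 : 16 * y ≤ cExp m0 v mε Φ cPi := by rw [cExp]; linarith
    calc 512 * expStep m0 v c mε Φ cPi * y = 32 * expStep m0 v c mε Φ cPi * (16 * y) := by ring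
      _ ≤ 32 * expStep m0 v c mε Φ cPi * cExp m0 v mε Φ cPi := by gcongr
      _ ≤ 1 := hE
  refine ⟨hβ, hm0, hmε, hv, hc, key _ ((le_max_left _ _).trans (le_max_left _ _)),
    key _ ((le_max_left _ _).trans (le_max_right _ _)),
    key _ ((le_max_right _ _).trans (le_max_left _ _)), ?_⟩
  refine le_trans ?_ (expStep_mul_le (v := v) (c := c) (mε := mε) (Φ := Φ) (cPi := cPi) hm0)
  gcongr
  exact (le_max_right _ _).trans (le_max_right _ _)

theorem expStep_mul_mixing_le (hm0 : 0 < m0) :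
    256 * expStep m0 v c mε Φ cPi * (mε ^ 2 * Φ ^ 2 * cPi) ≤ 1 := by
  have hβ := expStep_pos (v := v) (c := c) (mε := mε) (Φ := Φ) (cPi := cPi) hm0
  have h1 : 8 * (mε ^ 2 * Φ ^ 2 * cPi) ≤ cExp m0 v mε Φ cPi := by
    have : 2 * mε ^ 2 * Φ ^ 2 * cPi ≤ max (max (4 * m0 ^ 2) (4 * v)) (max (4 * mε ^ 2)
      (2 * mε ^ 2 * Φ ^ 2 * cPi)) := (le_max_right _ _).trans (le_max_right _ _)
    rw [cExp]; linarith
  calc 256 * expStep m0 v c mε Φ cPi * (mε ^ 2 * Φ ^ 2 * cPi)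
      = 32 * expStep m0 v c mε Φ cPi * (8 * (mε ^ 2 * Φ ^ 2 * cPi)) := by ring
    _ ≤ 32 * expStep m0 v c mε Φ cPi * cExp m0 v mε Φ cPi := by gcongr
    _ ≤ 1 := expStep_mul_cExp_le hm0

theorem cPen_eq (m0 v c mε Φ cPi : ℝ) :
    cPen m0 v c mε Φ cPi = 1 / (16 * expStep m0 v c mε Φ cPi) := by
  rw [cPen, expStep]
  generalize min (cExp m0 v mε Φ cPi)⁻¹ (lamStar m0 c mε) = θ
  rw [one_div, show 16 * (θ / 32) = θ / 2 by ring, inv_div]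
  ring

theorem cNet2_nonneg (hm0 : 0 < m0) (hv : 0 < v) (hc : 0 < c) (hmε : 0 < mε) (hmΛ : 0 ≤ mΛ) :
    0 ≤ cNet2 m0 v c mε mΛ := by
  rw [cNet2]; positivity

theorem le_cAdapt1 (hm0 : 0 < m0) (hv : 0 < v) (hc : 0 < c) (hmε : 0 < mε) (hmΛ : 0 ≤ mΛ) :
    20 / expStep m0 v c mε Φ cPi ≤ cAdapt1 m0 v c mε mΛ Φ cPi := by
  have h1 := cNet2_nonneg hm0 hv hc hmε hmΛ
  have h2 : 0 < cPen m0 v c mε Φ cPi := by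
    rw [cPen_eq]
    have := expStep_pos (v := v) (c := c) (mε := mε) (Φ := Φ) (cPi := cPi) hm0
    positivity
  have h3 : cNet1 m0 v c mε Φ cPi = 1 / expStep m0 v c mε Φ cPi := by
    have : cNet1 m0 v c mε Φ cPi = 16 * cPen m0 v c mε Φ cPi := by rw [cNet1, cPen]; ring
    rw [this, cPen_eq]
    have := expStep_pos (v := v) (c := c) (mε := mε) (Φ := Φ) (cPi := cPi) hm0
    field_simp
  rw [cAdapt1, cFixed, h3]
  have h4 : 0 ≤ 72 * m0 * mΛ * c := by positivity
  have h5 : 0 ≤ 72 * m0 * c := by positivity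
  have h6 : 0 ≤ 9 * m0 * cNet2 m0 v c mε mΛ := by positivity
  have h7 : 20 / expStep m0 v c mε Φ cPi = 4 * (5 * (1 / expStep m0 v c mε Φ cPi)) := by ring
  linarith

theorem cAdapt2_nonneg (hm0 : 0 < m0) (hv : 0 < v) (hc : 0 < c) (hmε : 0 < mε) (hmΛ : 0 ≤ mΛ) :
    0 ≤ cAdapt2 m0 v c mε mΛ := by
  have h1 := cNet2_nonneg hm0 hv hc hmε hmΛ
  rw [cAdapt2]; positivity

theorem supEntry_nonneg {τ T : ℕ} (Λ : Matrix (Fin τ) (Fin T) ℂ) : 0 ≤ supEntry Λ :=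
  Real.iSup_nonneg fun _ => norm_nonneg _

end Constants

/-! ### The oracle inequality -/

/-- The arithmetic of the oracle inequality. Here `vh`, `vn`, `vA` are the squared distances to the
target of the estimator, of its neighbour in the net and of a near-minimizer in a competing model,
and `Rh`, `Rn`, `RA` the sums of their excess losses. -/
theorem oracle_arithmetic {N β m0 vh vn vA Rh Rn RA D I eh ek x : ℝ} (hβ : 0 < β) (hN : 0 < N)
    (hx : 1 ≤ x) (hnet : -β * Rn < N * (-β * vn + β * vn / 2) + (eh + x)) (hR : Rn - Rh ≤ D)
    (hD : β * D ≤ (9 + 3 * x) / 128) (hv : vh - vn ≤ 8 * m0 ^ 2 / N) (hm0 : 512 * β * m0 ^ 2 ≤ 1)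
    (hsel : β * Rh + eh ≤ β * RA + ek) (hA : β * RA < N * (β * vA + β * vA / 2) + x)
    (hI : vA ≤ I + 1 / (32 * β * N)) :
    N * β * vh ≤ 3 * (N * β * I) + 2 * ek + 10 * x := by
  have h1 : N * β * vh ≤ N * β * vn + 1 / 64 := by
    have h2 : N * β * (vh - vn) ≤ N * β * (8 * m0 ^ 2 / N) := by gcongr
    have h3 : N * β * (8 * m0 ^ 2 / N) = 8 * (β * m0 ^ 2) := by field_simp
    rw [h3] at h2
    linarith
  have h4 : N * β * vA ≤ N * β * I + 1 / 32 := by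
    have h5 : N * β * vA ≤ N * β * (I + 1 / (32 * β * N)) := by gcongr
    have h6 : N * β * (I + 1 / (32 * β * N)) = N * β * I + 1 / 32 := by field_simp
    linarith
  have h7 : β * (Rn - Rh) ≤ β * D := by gcongr
  linarith

/-- The discretization error of the empirical risk, when the empirical mean of `|ξ_i|` is of the
order of the noise parameters. -/
theorem sum_excessLoss_sub_le {d T n : ℕ} (hn : 1 ≤ n) {m0 mε v c x : ℝ} (hm0 : 0 < m0)
    (hc : 0 < c) (hx : 0 ≤ x) {f g : Matrix (Fin d) (Fin T) ℂ}
    (hf : ∀ j t, ‖f j t‖ ≤ 2 * m0) (hg : ∀ j t, ‖g j t‖ ≤ 2 * m0)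
    (hfg : ∀ j t, ‖f j t - g j t‖ ≤ 2 * m0 / n) {e : Matrix (Fin d) (Fin T) ℝ}
    (he : ∀ j t, |e j t| ≤ mε) {X : Fin n → Matrix (Fin d) (Fin T) ℝ}
    (hX : ∀ i, X i ∈ entryMatrices d T) {z : Fin n → ℝ}
    (hz : 1 / (2 * c + Real.sqrt v) * ∑ i, |z i| ≤ n * 2 + x) :
    ∑ i, excessLoss g e (X i) (z i) - ∑ i, excessLoss f e (X i) (z i) ≤
      8 * m0 ^ 2 + 4 * (m0 * mε) + 4 * (2 + x) * (m0 * (2 * c + Real.sqrt v)) := by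
  have hn' : (1 : ℝ) ≤ n := by exact_mod_cast hn
  have hw : 0 < 2 * c + Real.sqrt v := by positivity
  have hz' : ∑ i, |z i| ≤ n * (2 + x) * (2 * c + Real.sqrt v) := by
    rw [one_div, inv_mul_le_iff₀ hw] at hz
    refine hz.trans ?_
    rw [mul_comm]
    gcongr
    nlinarith
  rw [← Finset.sum_sub_distrib]
  calc ∑ i, (excessLoss g e (X i) (z i) - excessLoss f e (X i) (z i))
      ≤ ∑ i, (2 * m0 / n * (2 * (2 * m0)) + 2 * (2 * m0 / n) * (mε + |z i|)) :=
        Finset.sum_le_sum fun i _ => excessLoss_sub_excessLoss_le hf hg hfg he (hX i) (z i)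
    _ = 8 * m0 ^ 2 + 4 * (m0 * mε) + 4 * m0 / n * ∑ i, |z i| := by
        rw [Finset.sum_add_distrib, ← Finset.mul_sum _ _ (2 * (2 * m0 / (n : ℝ))),
          Finset.sum_add_distrib]
        simp only [Finset.sum_const, Finset.card_univ, Fintype.card_fin, nsmul_eq_mul]
        field_simp
        ring
    _ ≤ 8 * m0 ^ 2 + 4 * (m0 * mε) +
          4 * m0 / n * (n * (2 + x) * (2 * c + Real.sqrt v)) := by gcongr
    _ = _ := by field_simp

theorem IsSmallStep.mul_discretization_le {β m0 mε v c : ℝ} (h : IsSmallStep β m0 mε v c) {x : ℝ}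
    (hx : 0 ≤ x) :
    β * (8 * m0 ^ 2 + 4 * (m0 * mε) + 4 * (2 + x) * (m0 * (2 * c + Real.sqrt v))) ≤
      (9 + 3 * x) / 128 := by
  have h0 := h.pos
  have h1 := h.m0_sq
  have h2 := h.mε_sq
  have h3 := h.v_le
  have h4 := h.m0_c
  have h5 : 512 * (β * (m0 * mε)) ≤ 1 := by
    have := mul_nonneg h0.le (sq_nonneg (m0 - mε))
    linarith
  have h6 : 512 * (β * (m0 * Real.sqrt v)) ≤ 1 := by
    have h7 := mul_nonneg h0.le (sq_nonneg (m0 - Real.sqrt v))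
    have h8 := Real.sq_sqrt h.v_pos.le
    have h9 : β * (m0 - Real.sqrt v) ^ 2 = β * m0 ^ 2 + β * v - 2 * (β * (m0 * Real.sqrt v)) := by
      rw [← h8, sub_sq, Real.sqrt_sq (Real.sqrt_nonneg _)]; ring
    linarith
  have h10 : 512 * (β * (m0 * (2 * c + Real.sqrt v))) ≤ 3 := by linarith
  have h11 : (2 + x) * (512 * (β * (m0 * (2 * c + Real.sqrt v)))) ≤ (2 + x) * 3 := by gcongr
  linarith

/-- In the union bound each net counts for a single point, as its entropy is part of the
deviation. -/
theorem card_mul_exp_neg_entropy {d k τ n : ℕ} (hn : 1 ≤ n) (x : ℝ) :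
    ∑ _p : (Fin d → Fin k → Fin n) × (Fin k → Fin τ → Fin n),
      ENNReal.ofReal (Real.exp (-(((k * (d + τ) : ℕ) : ℝ) * Real.log n + x))) =
        ENNReal.ofReal (Real.exp (-x)) := by
  have hn' : (0 : ℝ) < n := by exact_mod_cast hn
  rw [Finset.sum_const, Finset.card_univ, card_net, nsmul_eq_mul, ← ENNReal.ofReal_natCast,
    ← ENNReal.ofReal_mul (by positivity), neg_add, Real.exp_add, Real.exp_neg, Real.exp_nat_mul,
    Real.exp_log hn', ← mul_assoc]
  push_cast
  rw [mul_inv_cancel₀ (by positivity), one_mul]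

theorem theorem3
    {Ω Ω' : Type*} [MeasurableSpace Ω] [MeasurableSpace Ω']
    (P : Measure Ω) [IsProbabilityMeasure P] (P' : Measure Ω') [IsProbabilityMeasure P']
    -- dimensions and sample size
    (d T τ n : ℕ) (hd : 1 ≤ d) (hτ : 1 ≤ τ) (hτT : τ ≤ T) (hnT : n ≤ d * T)
    (hn : max d τ ≤ n)
    -- the structure matrix and the unknown coefficient matrix of the trend
    (Λ : Matrix (Fin τ) (Fin T) ℂ) (m0 mΛτ : ℝ) (hm0 : 0 < m0) (hmΛτ : 1 ≤ mΛτ)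
    (hΛ : ∀ (S : Matrix (Fin d) (Fin τ) ℝ) (b : ℝ), (∀ j l, |S j l| ≤ b) →
      ∀ j t, ‖trend S Λ j t‖ ≤ mΛτ * b)
    (T0 : Matrix (Fin d) (Fin τ) ℝ) (hT0 : ∀ j l, |T0 j l| ≤ m0 / mΛτ)
    -- the design, the observation noise, the time series noise, and the observations
    (X : Fin n → Ω → Matrix (Fin d) (Fin T) ℝ) (ξ : Fin n → Ω → ℝ)
    (ε : Ω → Matrix (Fin d) (Fin T) ℝ) (Y : Fin n → Ω → ℂ)
    (hXm : ∀ i, Measurable (X i)) (hξm : ∀ i, Measurable (ξ i)) (hεm : Measurable ε)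
    (hY : ∀ i ω, Y i ω = frobInner (X i ω) (trend T0 Λ + toComplex (ε ω)) + (ξ i ω : ℂ))
    -- the `X i` have common law `law` on the matrices `e_j e_t^*`, the `ξ i` are identically
    -- distributed and centered, and everything is independent
    (law : Measure (Matrix (Fin d) (Fin T) ℝ)) (hXlaw : ∀ i, P.map (X i) = law)
    (hXmem : ∀ i, ∀ᵐ ω ∂P, X i ω ∈ entryMatrices d T)
    (hξid : ∀ i i', IdentDistrib (ξ i) (ξ i') P P)
    (hξ0 : ∀ i, ∫ ω, ξ i ω ∂P = 0)
    (hpairs : iIndepFun (fun i ω => (X i ω, ξ i ω)) P)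
    (hXξ : ∀ i, IndepFun (X i) (ξ i) P)
    (hXξε : IndepFun (fun ω i => (X i ω, ξ i ω)) ε P)
    -- the rows of `ε` are i.i.d., centered, distributed as `(Z 1, …, Z T)` for a process `Z`
    (hεind : iIndepFun (fun j ω => ε ω j) P)
    (hε0 : ∀ j t, ∫ ω, ε ω j t ∂P = 0)
    (Z : ℤ → Ω' → ℝ) (hZm : ∀ t, Measurable (Z t))
    (hεZ : ∀ j, IdentDistrib (fun ω => ε ω j)
      (fun ω' (t : Fin T) => Z (((t : ℕ) : ℤ) + 1) ω') P P')
    -- boundedness of `ε` and moments of the `ξ i`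
    (mε vξ cξ : ℝ) (hmε : 0 < mε) (hvξ : 0 < vξ) (hcξ : 0 < cξ)
    (hεb : ∀ᵐ ω ∂P, ∀ j t, |ε ω j t| ≤ mε)
    (hξ2 : ∀ i, Integrable (fun ω => ξ i ω ^ 2) P ∧ ∫ ω, ξ i ω ^ 2 ∂P ≤ vξ)
    (hξq : ∀ q : ℕ, 3 ≤ q → ∀ i, Integrable (fun ω => |ξ i ω| ^ q) P ∧
      ∫ ω, |ξ i ω| ^ q ∂P ≤ vξ * cξ ^ (q - 2) * (Nat.factorial q : ℝ) / 2)
    -- the sampling probabilities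
    (cPi : ℝ) (hcPi : 0 < cPi)
    (hlaw : ∀ j t, law.real {Matrix.single j t 1} ≤ cPi / ((d : ℝ) * T))
    -- the models, the least squares estimators and the selected rank
    (kstar : ℕ) (hkstar : 1 ≤ kstar)
    (S : ℕ → Set (Matrix (Fin d) (Fin τ) ℝ))
    (hS : ∀ k ∈ Finset.Icc 1 kstar, S k ⊆ factorSet d k τ m0 mΛτ)
    (That : ℕ → Ω → Matrix (Fin d) (Fin τ) ℝ)
    (hThat : ∀ k ∈ Finset.Icc 1 kstar, ∀ ω, That k ω ∈ S k ∧ ∀ A ∈ S k,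
      empiricalRisk (fun i => Y i ω) (fun i => X i ω) (trend (That k ω) Λ) ≤
        empiricalRisk (fun i => Y i ω) (fun i => X i ω) (trend A Λ))
    (khat : Ω → ℕ)
    (hkhat : ∀ ω, khat ω ∈ Finset.Icc 1 kstar ∧ ∀ k ∈ Finset.Icc 1 kstar,
      empiricalRisk (fun i => Y i ω) (fun i => X i ω) (trend (That (khat ω) ω) Λ)
          + pen (cPen m0 vξ cξ mε (mixingSum P' Z n) cPi) n d τ (khat ω) ≤
        empiricalRisk (fun i => Y i ω) (fun i => X i ω) (trend (That k ω) Λ)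
          + pen (cPen m0 vξ cξ mε (mixingSum P' Z n) cPi) n d τ k)
    -- the confidence level
    (α : ℝ) (hα : α ∈ Set.Ioo (0 : ℝ) 1) :
    -- outside an event of probability at most `α`, the oracle inequality holds
    P {ω | ¬ (normSqPi law (trend (That (khat ω) ω) Λ - trend T0 Λ) ≤
        4 * (⨅ k : Finset.Icc 1 kstar,
          (3 * (⨅ A : S k, normSqPi law (trend ((A : Matrix (Fin d) (Fin τ) ℝ) - T0) Λ))
            + cAdapt1 m0 vξ cξ mε (supEntry Λ) (mixingSum P' Z n) cPi
              * (k : ℕ) * ((d : ℝ) + τ) * (Real.log n / n)))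
        + cAdapt1 m0 vξ cξ mε (supEntry Λ) (mixingSum P' Z n) cPi / n
            * Real.log (4 * kstar / α)
        + cAdapt2 m0 vξ cξ mε (supEntry Λ) / n)} ≤ ENNReal.ofReal α := by
  classical
  have hn1 : 1 ≤ n := hd.trans ((le_max_left d τ).trans hn)
  have hT : 1 ≤ T := hτ.trans hτT
  have hn' : (0 : ℝ) < n := by exact_mod_cast hn1
  have hk' : (1 : ℝ) ≤ kstar := by exact_mod_cast hkstar
  set Φ := mixingSum P' Z n with hΦ
  set β := expStep m0 vξ cξ mε Φ cPi with hβdef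
  have hβ : 0 < β := expStep_pos hm0
  have hstep : IsSmallStep β m0 mε vξ cξ := isSmallStep_expStep hm0 hvξ hcξ hmε
  have hmem0 : ∀ᵐ x ∂law, x ∈ entryMatrices d T := by
    rw [← hXlaw ⟨0, hn1⟩]
    exact ae_map_mem_entryMatrices (hXm _) (hXmem _)
  have hlawP : IsProbabilityMeasure law := by
    rw [← hXlaw ⟨0, hn1⟩]
    exact Measure.isProbabilityMeasure_map (hXm _).aemeasurable
  -- `exp (-x) = α / (4 k*)`, which suffices for the `2 k* + 1` terms of the union bound
  set x := Real.log (4 * kstar / α) with hxdef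
  have hx1 : 1 ≤ x := by
    rw [hxdef, Real.le_log_iff_exp_le (by have := hα.1; positivity), le_div_iff₀ hα.1]
    have h1 := Real.exp_one_lt_d9
    have h2 := hα.1
    have h3 := hα.2
    nlinarith
  have hexpx : Real.exp (-x) = α / (4 * kstar) := by
    have := hα.1
    rw [Real.exp_neg, hxdef, Real.exp_log (by positivity), inv_div]
  obtain ⟨ω₀⟩ : Nonempty Ω := nonempty_of_isProbabilityMeasure P
  set K := Finset.Icc 1 kstar with hK
  -- differences to the target, and their bounds
  set F : Matrix (Fin d) (Fin τ) ℝ → Matrix (Fin d) (Fin T) ℂ :=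
    fun A => trend A Λ - trend T0 Λ with hF
  have hmΛτ0 : 0 < mΛτ := by linarith
  have hFb : ∀ k ∈ K, ∀ A ∈ factorSet d k τ m0 mΛτ, ∀ j t, ‖F A j t‖ ≤ 2 * m0 := by
    intro k hk A hA j t
    have h1 := hΛ A _ (abs_le_of_mem_factorSet (Finset.mem_Icc.1 hk).1 hm0 hmΛτ hA) j t
    have h2 := hΛ T0 _ hT0 j t
    rw [mul_div_cancel₀ _ hmΛτ0.ne'] at h1 h2
    refine (norm_sub_le _ _).trans ?_
    linarith
  set ent : ℕ → ℝ := fun k => ((k * (d + τ) : ℕ) : ℝ) * Real.log n with hent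
  have hent0 : ∀ k, 0 ≤ ent k := fun k =>
    mul_nonneg (Nat.cast_nonneg _) (Real.log_natCast_nonneg n)
  set R : Matrix (Fin d) (Fin τ) ℝ → Ω → ℝ :=
    fun A ω => ∑ i, excessLoss (F A) (ε ω) (X i ω) (ξ i ω) with hR
  have hRm : ∀ A, Measurable (R A) := by
    intro A
    have h : Measurable fun ω => ((fun i => (X i ω, ξ i ω) : Fin n → _), ε ω) :=
      (measurable_pi_lambda _ fun i => (hXm i).prodMk (hξm i)).prodMk hεm
    have h2 := (measurable_sum_excessLoss (n := n) (F A)).comp h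
    exact h2
  have hdev : ∀ k ∈ K, ∀ A ∈ factorSet d k τ m0 mΛτ, ∀ s : ℝ, |s| = β → ∀ y : ℝ,
      P {ω | n * (s * normSqPi law (F A) + β * normSqPi law (F A) / 2) + y ≤ s * R A ω} ≤
        ENNReal.ofReal (Real.exp (-y)) := by
    intro k hk A hA s hs y
    exact measure_add_le_of_lintegral_exp_le ((hRm A).const_mul s)
      (lintegral_exp_sum_excessLoss_noise_le hd hT hn1 hnT hXm hξm hεm hXlaw hpairs hXξ hXξε hXmem
        hstep hξ0 hξ2 hξq hcPi.le hlaw hεind hε0 hZm hεZ hεb (expStep_mul_mixing_le hm0)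
        (hFb k hk A hA) hs) y
  -- a near-minimizer of the approximation error in each model
  have hchoice : ∀ k, ∃ A, k ∈ K → A ∈ S k ∧ normSqPi law (F A) ≤
      (⨅ A : S k, normSqPi law (trend ((A : Matrix (Fin d) (Fin τ) ℝ) - T0) Λ)) +
        1 / (32 * β * n) := by
    intro k
    by_cases hk : k ∈ K
    · have hne : Nonempty (S k) := ⟨⟨That k ω₀, (hThat k hk ω₀).1⟩⟩
      have hpos : 0 < 1 / (32 * β * n) := by positivity
      obtain ⟨A, hA⟩ := exists_lt_of_ciInf_lt (lt_add_of_pos_right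
        (⨅ A : S k, normSqPi law (trend ((A : Matrix (Fin d) (Fin τ) ℝ) - T0) Λ)) hpos)
      rw [trend_sub] at hA
      exact ⟨A, fun _ => ⟨A.2, hA.le⟩⟩
    · exact ⟨0, fun h => absurd h hk⟩
  choose best hbest using hchoice
  set net : (k : ℕ) → (Fin d → Fin k → Fin n) × (Fin k → Fin τ → Fin n) →
    Matrix (Fin d) (Fin τ) ℝ := fun k p => netPoint (Real.sqrt (m0 / (k * mΛτ))) p with hnet
  set u := 1 / (2 * cξ + Real.sqrt vξ) with hu
  have hw : 0 < 2 * cξ + Real.sqrt vξ := by positivity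
  have hu0 : 0 < u := by positivity
  have huc : u * cξ ≤ 1 / 2 := by
    rw [hu, one_div, inv_mul_le_iff₀ hw]
    linarith [Real.sqrt_nonneg vξ]
  have huv : u ^ 2 * vξ ≤ 1 := by
    have h1 : u * Real.sqrt vξ ≤ 1 := by
      rw [hu, one_div, inv_mul_le_iff₀ hw]; linarith
    calc u ^ 2 * vξ = (u * Real.sqrt vξ) ^ 2 := by rw [mul_pow, Real.sq_sqrt hvξ.le]
      _ ≤ 1 := pow_le_one₀ (by positivity) h1
  -- the exceptional events
  set B₁ : (k : ℕ) → (Fin d → Fin k → Fin n) × (Fin k → Fin τ → Fin n) → Set Ω := fun k p =>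
    {ω | n * (-β * normSqPi law (F (net k p)) + β * normSqPi law (F (net k p)) / 2) +
      (ent k + x) ≤ -β * R (net k p) ω} with hB₁
  set B₂ : ℕ → Set Ω := fun k =>
    {ω | n * (β * normSqPi law (F (best k)) + β * normSqPi law (F (best k)) / 2) + x ≤
      β * R (best k) ω} with hB₂
  set B₃ : Set Ω := {ω | n * 2 + x ≤ u * ∑ i, |ξ i ω|} with hB₃
  set B₀ : Set Ω := {ω | ¬ ((∀ i, X i ω ∈ entryMatrices d T) ∧ ∀ j t, |ε ω j t| ≤ mε)} with hB₀
  have hP₀ : P B₀ = 0 := by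
    have h : ∀ᵐ ω ∂P, (∀ i, X i ω ∈ entryMatrices d T) ∧ ∀ j t, |ε ω j t| ≤ mε :=
      (ae_all_iff.2 hXmem).and hεb
    exact h
  have hP₁ : P (⋃ k ∈ K, ⋃ p, B₁ k p) ≤ ∑ _k ∈ K, ENNReal.ofReal (Real.exp (-x)) := by
    refine (measure_biUnion_finset_le _ _).trans (Finset.sum_le_sum fun k hk => ?_)
    refine (measure_iUnion_fintype_le _ _).trans ?_
    rw [← card_mul_exp_neg_entropy (d := d) (k := k) (τ := τ) hn1 x]
    refine Finset.sum_le_sum fun p _ => ?_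
    exact hdev k hk _ (netPoint_mem_factorSet p) (-β) (by rw [abs_neg, abs_of_pos hβ]) _
  have hP₂ : P (⋃ k ∈ K, B₂ k) ≤ ∑ _k ∈ K, ENNReal.ofReal (Real.exp (-x)) := by
    refine (measure_biUnion_finset_le _ _).trans (Finset.sum_le_sum fun k hk => ?_)
    exact hdev k hk _ (hS k hk (hbest k hk).1) β (abs_of_pos hβ) x
  have hP₃ : P B₃ ≤ ENNReal.ofReal (Real.exp (-x)) :=
    measure_sum_abs_ge_le hξm (hpairs.comp (fun _ p => p.2) fun _ => measurable_snd) hvξ.le hcξ.le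
      hξ2 hξq hu0.le huc huv x
  have hbad : P (B₀ ∪ (⋃ k ∈ K, ⋃ p, B₁ k p) ∪ (⋃ k ∈ K, B₂ k) ∪ B₃) ≤ ENNReal.ofReal α := by
    have h1 : P (B₀ ∪ (⋃ k ∈ K, ⋃ p, B₁ k p) ∪ (⋃ k ∈ K, B₂ k) ∪ B₃) ≤
        0 + ∑ _k ∈ K, ENNReal.ofReal (Real.exp (-x)) + ∑ _k ∈ K, ENNReal.ofReal (Real.exp (-x)) +
          ENNReal.ofReal (Real.exp (-x)) := by
      refine (measure_union_le _ _).trans (add_le_add ?_ hP₃)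
      refine (measure_union_le _ _).trans (add_le_add ?_ hP₂)
      exact (measure_union_le _ _).trans (add_le_add hP₀.le hP₁)
    refine h1.trans ?_
    have hcard : K.card = kstar := by simp [hK]
    rw [Finset.sum_const, hcard, nsmul_eq_mul, hexpx, zero_add, ← ENNReal.ofReal_natCast]
    have hα0 := hα.1
    have hq : 0 ≤ α / (4 * kstar) := by positivity
    rw [← ENNReal.ofReal_mul (by positivity), ← ENNReal.ofReal_add (by positivity) (by positivity),
      ← ENNReal.ofReal_add (by positivity) hq]
    refine ENNReal.ofReal_le_ofReal ?_
    have h2 : (kstar : ℝ) * (α / (4 * kstar)) = α / 4 := by field_simp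
    have h3 : α / (4 * kstar) ≤ α / 4 := by gcongr; linarith
    linarith
  refine (measure_mono fun ω hω => ?_).trans hbad
  by_contra hgood
  simp only [Set.mem_union, Set.mem_iUnion, not_or, not_exists] at hgood
  obtain ⟨⟨⟨hg₀, hg₁⟩, hg₂⟩, hg₃⟩ := hgood
  simp only [hB₁, hB₂, hB₃, hB₀, Set.mem_ofPred_eq, not_le, not_not] at hg₀ hg₁ hg₂ hg₃
  refine hω ?_
  obtain ⟨hkh, hsel⟩ := hkhat ω
  obtain ⟨hThS, -⟩ := hThat (khat ω) hkh ω
  have hkh1 : 1 ≤ khat ω := (Finset.mem_Icc.1 hkh).1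
  set A := That (khat ω) ω with hA
  have hAf : A ∈ factorSet d (khat ω) τ m0 mΛτ := hS _ hkh hThS
  obtain ⟨p, hp⟩ := exists_netPoint hkh1 hn1 hm0 hmΛτ hAf
  have hclose : ∀ j t, ‖F A j t - F (net (khat ω) p) j t‖ ≤ 2 * m0 / n := by
    intro j t
    have h1 := hΛ _ _ hp j t
    have h2 : F A j t - F (net (khat ω) p) j t = trend (A - net (khat ω) p) Λ j t := by
      rw [trend_sub]; simp [hF]
    rw [h2]
    refine h1.trans (le_of_eq ?_)
    field_simp
  have hAb := hFb _ hkh A hAf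
  have hnb := hFb _ hkh _ (netPoint_mem_factorSet (m0 := m0) (mΛτ := mΛτ) p)
  have hdisc := sum_excessLoss_sub_le hn1 hm0 hcξ (by linarith) hAb hnb hclose hg₀.2 hg₀.1 hg₃.le
  have hvdiff : normSqPi law (F A) - normSqPi law (F (net (khat ω) p)) ≤ 8 * m0 ^ 2 / n := by
    refine (normSqPi_sub_normSqPi_le hmem0 hAb hnb hclose).trans (le_of_eq ?_)
    ring
  have hrisk : ∀ B, empiricalRisk (fun i => Y i ω) (fun i => X i ω) (trend B Λ) -
      empiricalRisk (fun i => Y i ω) (fun i => X i ω) (trend T0 Λ) = 1 / (n : ℝ) * R B ω :=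
    fun B => empiricalRisk_sub_empiricalRisk fun i => hY i ω
  have hpen : ∀ k, β * n * pen (cPen m0 vξ cξ mε Φ cPi) n d τ k = ent k := by
    intro k
    rw [pen, cPen_eq, ← hβdef, hent]
    push_cast
    field_simp
  have hmain : ∀ k ∈ K, n * β * normSqPi law (F A) ≤ 3 * (n * β *
      (⨅ A : S k, normSqPi law (trend ((A : Matrix (Fin d) (Fin τ) ℝ) - T0) Λ))) +
        2 * ent k + 10 * x := by
    intro k hk
    have hselk : β * R A ω + ent (khat ω) ≤ β * R (best k) ω + ent k := by
      have h1 := hsel k hk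
      have h2 := (hThat k hk ω).2 _ (hbest k hk).1
      have h3 := hrisk A
      have h4 := hrisk (best k)
      have h5 : 1 / (n : ℝ) * R A ω + pen (cPen m0 vξ cξ mε Φ cPi) n d τ (khat ω) ≤
          1 / (n : ℝ) * R (best k) ω + pen (cPen m0 vξ cξ mε Φ cPi) n d τ k := by linarith
      have h6 : β * n * (1 / (n : ℝ) * R A ω + pen (cPen m0 vξ cξ mε Φ cPi) n d τ (khat ω)) ≤
          β * n * (1 / (n : ℝ) * R (best k) ω + pen (cPen m0 vξ cξ mε Φ cPi) n d τ k) := by gcongr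
      have h7 : ∀ r : ℝ, β * n * (1 / (n : ℝ) * r) = β * r := fun r => by field_simp
      rwa [mul_add, mul_add, hpen, hpen, h7, h7] at h6
    exact oracle_arithmetic hβ hn' hx1 (hg₁ _ hkh p) hdisc
      (hstep.mul_discretization_le (by linarith)) hvdiff hstep.m0_sq hselk (hg₂ k hk)
      (hbest k hk).2
  have hc1 := le_cAdapt1 (v := vξ) (c := cξ) (Φ := Φ) (cPi := cPi) hm0 hvξ hcξ hmε
    (supEntry_nonneg Λ)
  have hc2 := cAdapt2_nonneg hm0 hvξ hcξ hmε (supEntry_nonneg Λ)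
  rw [← hβdef] at hc1
  set c₁ := cAdapt1 m0 vξ cξ mε (supEntry Λ) Φ cPi with hc₁
  have hc₁0 : 0 ≤ c₁ := le_trans (by positivity) hc1
  have hKne : Nonempty K := ⟨⟨1, Finset.mem_Icc.2 ⟨le_rfl, hkstar⟩⟩⟩
  have hfin : (normSqPi law (F A) - c₁ / n * x - cAdapt2 m0 vξ cξ mε (supEntry Λ) / n) / 4 ≤
      ⨅ k : K, (3 * (⨅ A : S k, normSqPi law (trend ((A : Matrix (Fin d) (Fin τ) ℝ) - T0) Λ)) +
        c₁ * (k : ℕ) * ((d : ℝ) + τ) * (Real.log n / n)) := by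
    refine le_ciInf fun k => ?_
    have h1 := hmain k k.2
    have hI : 0 ≤ ⨅ A : S k, normSqPi law (trend ((A : Matrix (Fin d) (Fin τ) ℝ) - T0) Λ) :=
      Real.iInf_nonneg fun A => integral_nonneg fun _ => sq_nonneg _
    set I := ⨅ A : S k, normSqPi law (trend ((A : Matrix (Fin d) (Fin τ) ℝ) - T0) Λ)
    have h2 : c₁ * ((k : ℕ) : ℝ) * ((d : ℝ) + τ) * (Real.log n / n) = c₁ / n * ent k := by
      simp only [hent]; push_cast; ring
    rw [h2]
    have h3 : 0 ≤ cAdapt2 m0 vξ cξ mε (supEntry Λ) / n := by positivity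
    have h4 : normSqPi law (F A) ≤ 3 * I + (2 * ent k + 10 * x) / (n * β) := by
      rw [← sub_le_iff_le_add', le_div_iff₀ (by positivity)]
      linarith
    have h5 : (2 * ent k + 10 * x) / (n * β) ≤ c₁ / n * (2 * ent k + 10 * x) / 20 := by
      have h6 : (2 * ent k + 10 * x) / (n * β) = 20 / β / n * (2 * ent k + 10 * x) / 20 := by
        field_simp
      have h7 : 0 ≤ 2 * ent k + 10 * x := by linarith [hent0 k]
      rw [h6]
      gcongr
    have h8 : 0 ≤ c₁ / n * ent k :=
      mul_nonneg (div_nonneg hc₁0 hn'.le) (hent0 k)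
    have h9 : 0 ≤ c₁ / n * x :=
      mul_nonneg (div_nonneg hc₁0 hn'.le) (by linarith)
    linarith
  linarith
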